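/- Let $1<m<n$, let $M$ be a smooth $n$-manifold with a Finsler fundamental function $F$ (smooth off the null section, with $g_{ab}=\frac12\partial^2F^2/\partial y^{(1)a}\partial y^{(1)b}$ positive definite), let $\check M$ be a smooth $m$-manifold and $\check M\to M$ an immersion, given in local charts by $x^a=x^a(u^1,\dots,u^m)$. Let $(u,v^{(1)},v^{(2)})$ be the induced coordinates on the 2-osculator bundle $Osc^2\check M$; all identities below are at points with $v^{(1)}\neq0$. Put $B^a_\alpha=\partial x^a/\partial u^\alpha$, let $B^a_{\bar\alpha}$ ($\bar\alpha=1,\dots,n-m$) be $g$-orthonormal normals, and let $B^\alpha_a,B^{\bar\alpha}_a$ be the dual frame. *The connections.* On $Osc^2M$ take the nonlinear connection with $\delta y^{(1)a}=dy^{(1)a}+M_{(1)}{}^a_b\,dx^b$, $\delta y^{(2)a}=dy^{(2)a}+M_{(1)}{}^a_b\,dy^{(1)b}+M_{(2)}{}^a_b\,dx^b$, where $M_{(1)}{}^a_b=\partial G^a/\partial y^{(1)b}$, $G^a=\frac12\gamma^a_{bc}y^{(1)b}y^{(1)c}$ ($\gamma^a_{bc}$ the Christoffel symbols of $g$ with respect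 to $x$), $M_{(2)}=\frac12(\Gamma M_{(1)}+M_{(1)}M_{(1)})$, $\Gamma=y^{(1)a}\partial_{x^a}+2y^{(2)a}\partial_{y^{(1)a}}$. Let $\delta_a=\delta_{0a},\delta_{1a},\delta_{2a}$ be the frame dual to $dx^a,\delta y^{(1)a},\delta y^{(2)a}$, and write $B_{(jj)}{}^a_{bc}$ for the $\delta_{ja}$-component of $[\delta_b,\delta_{jc}]$. The canonical metrical $N$-linear connection has the coefficients ($k=0,2$; $l=0,1$; $j=1,2$) $$L_{(00)}{}^a_{bc}=\tfrac12g^{ad}(\delta_bg_{dc}+\delta_cg_{bd}-\delta_dg_{bc}),\qquad C_{(jj)}{}^a_{bc}=\tfrac12g^{ad}(\delta_{jb}g_{dc}+\delta_{jc}g_{bd}-\delta_{jd}g_{bc}),$$ $$L_{(j0)}{}^a_{bc}=B_{(jj)}{}^a_{cb}+\tfrac12g^{ad}\bigl(\delta_cg_{bd}-B_{(jj)}{}^f_{cb}g_{fd}-B_{(jj)}{}^f_{cd}g_{bf}\bigr),\quad C_{(k1)}{}^a_{bc}=\tfrac12g^{ad}\delta_{1c}g_{bd},\quad C_{(l2)}{}^a_{bc}=\tfrac12g^{ad}\delta_{2c}g_{bd}.$$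 The induced nonlinear connection on $Osc^2\check M$ is the one with $\delta v^{(1)\alpha}=B^\alpha_a\delta y^{(1)a}$, $\delta v^{(2)\alpha}=B^\alpha_a\delta y^{(2)a}$ (forms pulled back); let $\delta_\beta=\delta_{0\beta},\delta_{1\beta},\delta_{2\beta}$ be the frame dual to $du^\beta,\delta v^{(1)\beta},\delta v^{(2)\beta}$. Let $\check L_{(i0)}{}^a_{b\delta},\check C_{(i1)}{}^a_{b\delta},\check C_{(i2)}{}^a_{b\delta}$ be the coefficients of $du^\delta,\delta v^{(1)\delta},\delta v^{(2)\delta}$ in the pullback of $L_{(i0)}{}^a_{bd}dx^d+C_{(i1)}{}^a_{bd}\delta y^{(1)d}+C_{(i2)}{}^a_{bd}\delta y^{(2)d}$. The induced tangent $N$-linear connection has, for $i=0,1,2$ and $j=1,2$, the coefficients $$L_{(i0)}{}^\alpha_{\beta\delta}=B^\alpha_d\Bigl(\tfrac{\partial^2x^d}{\partial u^\beta\partial u^\delta}+B^f_\beta\check L_{(i0)}{}^d_{f\delta}\Bigr),\qquad C_{(ij)}{}^\alpha_{\beta\delta}=B^\alpha_dB^f_\beta\check C_{(ij)}{}^d_{f\delta}.$$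 *Covariant derivatives.* $X^\alpha|_{i\beta}=\delta_\beta X^\alpha+L_{(i0)}{}^\alpha_{\sigma\beta}X^\sigma$ and $X^\alpha|^{(j)}_{i\beta}=\delta_{j\beta}X^\alpha+C_{(ij)}{}^\alpha_{\sigma\beta}X^\sigma$; on a tensor $T^\alpha_\beta$ the same coefficients act on both indices, e.g. $T^\alpha_\beta|_{i\gamma}=\delta_\gamma T^\alpha_\beta+L_{(i0)}{}^\alpha_{\sigma\gamma}T^\sigma_\beta-L_{(i0)}{}^\sigma_{\beta\gamma}T^\alpha_\sigma$. *Curvature.* Let $D$ be the linear connection on $Osc^2\check M$ with $D_{\delta_\gamma}\delta_{i\beta}=L_{(i0)}{}^\alpha_{\beta\gamma}\delta_{i\alpha}$ and $D_{\delta_{j\gamma}}\delta_{i\beta}=C_{(ij)}{}^\alpha_{\beta\gamma}\delta_{i\alpha}$, and let $R(V,W)=D_VD_W-D_WD_V-D_{[V,W]}$ be its curvature. Then $R_{(0i)}{}_\delta{}^\alpha{}_{\beta\gamma}$, $P_{(ji)}{}_\delta{}^\alpha{}_{\beta\gamma}$, $Q_{(2i)}{}_\delta{}^\alpha{}_{\beta\gamma}$,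 $S_{(ji)}{}_\delta{}^\alpha{}_{\beta\gamma}$ are the $\delta_{i\alpha}$-components of $R(V,W)\delta_{i\delta}$ for $(V,W)=(\delta_\gamma,\delta_\beta)$, $(\delta_{j\gamma},\delta_\beta)$, $(\delta_{2\gamma},\delta_{1\beta})$, $(\delta_{j\gamma},\delta_{j\beta})$ respectively ($j=1,2$). *Torsion.* $R_{(jr)}{}^\sigma_{\beta\gamma}$ is the $\delta_{r\sigma}$-component of $[\delta_{j\beta},\delta_{j\gamma}]$; $P_{(12)}{}^\sigma_{\beta\gamma}$ and $P_{(21)}{}^\sigma_{\beta\gamma}$ are the $\delta_{2\sigma}$-component of $[\delta_\beta,\delta_{1\gamma}]$ and the $\delta_{1\sigma}$-component of $[\delta_\beta,\delta_{2\gamma}]$. Let $T^{(i)}(V,W)=D^{(i)}_VW-D^{(i)}_WV-[V,W]$ be the torsion of the connection $D^{(i)}$ that uses $(L_{(i0)},C_{(i1)},C_{(i2)})$ on all three distributions. Then $T^{(i)}_{(0)}{}^\sigma_{\beta\gamma}$ is the $\delta_\sigma$-component of $T^{(i)}(\delta_\gamma,\delta_\beta)$; $P^{(i)}_{(jj)}{}^\sigma_{\beta\gamma}$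 the $\delta_{j\sigma}$-component of $T^{(i)}(\delta_{j\gamma},\delta_\beta)$; $Q^{(i)}_{(22)}{}^\sigma_{\beta\gamma}$ the $\delta_{2\sigma}$-component of $T^{(i)}(\delta_{2\gamma},\delta_{1\beta})$; $S^{(i)}_{(j)}{}^\sigma_{\beta\gamma}$ the $\delta_{j\sigma}$-component of $T^{(i)}(\delta_{j\gamma},\delta_{j\beta})$. **Theorem.** For every d-vector field $X^\alpha$ on $Osc^2\check M$ (smooth where $v^{(1)}\ne0$), every $i=0,1,2$ and $j=1,2$: $$X^\alpha|_{i\beta}|_{i\gamma}-X^\alpha|_{i\gamma}|_{i\beta}=X^\delta R_{(0i)}{}_\delta{}^\alpha{}_{\beta\gamma}-T^{(i)}_{(0)}{}^\sigma_{\beta\gamma}X^\alpha|_{i\sigma}-R_{(01)}{}^\sigma_{\beta\gamma}X^\alpha|^{(1)}_{i\sigma}-R_{(02)}{}^\sigma_{\beta\gamma}X^\alpha|^{(2)}_{i\sigma},$$ $$X^\alpha|_{i\beta}|^{(1)}_{i\gamma}-X^\alpha|^{(1)}_{i\gamma}|_{i\beta}=X^\delta P_{(1i)}{}_\delta{}^\alpha{}_{\beta\gamma}-C_{(i1)}{}^\sigma_{\beta\gamma}X^\alpha|_{i\sigma}-P^{(i)}_{(11)}{}^\sigma_{\beta\gamma}X^\alpha|^{(1)}_{i\sigma}-P_{(12)}{}^\sigma_{\beta\gamma}X^\alpha|^{(2)}_{i\sigma},$$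 $$X^\alpha|_{i\beta}|^{(2)}_{i\gamma}-X^\alpha|^{(2)}_{i\gamma}|_{i\beta}=X^\delta P_{(2i)}{}_\delta{}^\alpha{}_{\beta\gamma}-C_{(i2)}{}^\sigma_{\beta\gamma}X^\alpha|_{i\sigma}-P_{(21)}{}^\sigma_{\beta\gamma}X^\alpha|^{(1)}_{i\sigma}-P^{(i)}_{(22)}{}^\sigma_{\beta\gamma}X^\alpha|^{(2)}_{i\sigma},$$ $$X^\alpha|^{(1)}_{i\beta}|^{(2)}_{i\gamma}-X^\alpha|^{(2)}_{i\gamma}|^{(1)}_{i\beta}=X^\delta Q_{(2i)}{}_\delta{}^\alpha{}_{\beta\gamma}-C_{(i2)}{}^\sigma_{\beta\gamma}X^\alpha|^{(1)}_{i\sigma}-Q^{(i)}_{(22)}{}^\sigma_{\beta\gamma}X^\alpha|^{(2)}_{i\sigma},$$ $$X^\alpha|^{(j)}_{i\beta}|^{(j)}_{i\gamma}-X^\alpha|^{(j)}_{i\gamma}|^{(j)}_{i\beta}=X^\delta S_{(ji)}{}_\delta{}^\alpha{}_{\beta\gamma}-S^{(i)}_{(j)}{}^\sigma_{\beta\gamma}X^\alpha|^{(j)}_{i\sigma}-R_{(j2)}{}^\sigma_{\beta\gamma}X^\alpha|^{(2)}_{i\sigma},$$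 and $R_{(22)}{}^\alpha_{\beta\gamma}=0$. -/

import Mathlib

open scoped Manifold ContDiff

noncomputable section

namespace OscRicci

/-! ## Coordinates on the 2-osculator bundle -/

/-- The coordinate space `ℝᵏ`. -/
abbrev E (k : ℕ) : Type := EuclideanSpace ℝ (Fin k)

/-- The coordinate space of `Osc²` of a `k`-dimensional manifold: the triples
`(x, y⁽¹⁾, y⁽²⁾)`. -/
abbrev OscC (k : ℕ) : Type := E k × E k × E k

/-- The natural basis `∂/∂xᵃ`, `∂/∂y⁽¹⁾ᵃ`, `∂/∂y⁽²⁾ᵃ` (for `j = 0, 1, 2`). -/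
def coordVec {k : ℕ} (j : Fin 3) (a : Fin k) : OscC k :=
  match j with
  | 0 => (EuclideanSpace.single a 1, 0, 0)
  | 1 => (0, EuclideanSpace.single a 1, 0)
  | 2 => (0, 0, EuclideanSpace.single a 1)

/-- The partial derivatives `∂f/∂xᵃ`, `∂f/∂y⁽¹⁾ᵃ`, `∂f/∂y⁽²⁾ᵃ` (for `j = 0, 1, 2`). -/
def pd {k : ℕ} (j : Fin 3) (a : Fin k) (f : OscC k → ℝ) (p : OscC k) : ℝ :=
  fderiv ℝ f p (coordVec j a)

/-! ## Smooth manifolds, the 2-osculator bundle and d-vector fields -/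

section Manifolds

variable (k : ℕ) (M : Type*) [TopologicalSpace M] [ChartedSpace (E k) M]

/-- The smooth local charts of `M`. -/
abbrev Chart : Type _ :=
  {φ : OpenPartialHomeomorph M (E k) // φ ∈ IsManifold.maximalAtlas (𝓡 k) ∞ M}

/-- Curves in `M` that are smooth on an open interval around `0`. -/
abbrev Curve : Type _ :=
  {ρ : ℝ → M // ∃ ε > 0, ContMDiffOn 𝓘(ℝ, ℝ) (𝓡 k) ∞ ρ (Set.Ioo (-ε) ε)}

/-- Contact of order 2 at the parameter `0`. -/
def contact : Setoid (Curve k M) where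
  r ρ σ := ρ.1 0 = σ.1 0 ∧ ∀ f : M → ℝ, ContMDiffAt (𝓡 k) 𝓘(ℝ, ℝ) ∞ f (ρ.1 0) →
    ∀ b : ℕ, b = 1 ∨ b = 2 → iteratedDeriv b (f ∘ ρ.1) 0 = iteratedDeriv b (f ∘ σ.1) 0
  iseqv :=
    { refl := fun _ => ⟨rfl, fun _ _ _ _ => rfl⟩
      symm := fun {ρ σ} h => ⟨h.1.symm, fun f hf b hb => (h.2 f (h.1 ▸ hf) b hb).symm⟩
      trans := fun {ρ σ τ} h h' => ⟨h.1.trans h'.1, fun f hf b hb =>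
        (h.2 f hf b hb).trans (h'.2 f (h.1 ▸ hf) b hb)⟩ }

/-- The total space of the 2-osculator bundle of `M`. -/
def Osc2 : Type _ := Quotient (contact k M)

variable {k M}

/-- The projection `π² : Osc²M → M`. -/
def Osc2.proj (w : Osc2 k M) : M :=
  Quotient.lift (s := contact k M) (fun ρ : Curve k M => ρ.1 0) (fun _ _ h => h.1) w

/-- The coordinates `xᵃ = xᵃ(0)`, `y⁽¹⁾ᵃ = dxᵃ/dt(0)`, `y⁽²⁾ᵃ = ½ d²xᵃ/dt²(0)` of a curve
that starts in the domain of the chart `φ`. -/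
def curveCoords (φ : Chart k M) (ρ : Curve k M) : OscC k :=
  open Classical in
  if ρ.1 0 ∈ φ.1.source then
    (φ.1 (ρ.1 0),
      WithLp.toLp 2 fun a => iteratedDeriv 1 ((fun q => φ.1 q a) ∘ ρ.1) 0,
      WithLp.toLp 2 fun a => (1 / 2) * iteratedDeriv 2 ((fun q => φ.1 q a) ∘ ρ.1) 0)
  else 0

theorem curveCoords_congr (φ : Chart k M) (ρ σ : Curve k M) (h : contact k M ρ σ) :
    curveCoords φ ρ = curveCoords φ σ := by
  have h0 : ρ.1 0 = σ.1 0 := h.1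
  unfold curveCoords
  rw [← h0]
  split_ifs with hs
  · have hsm : ∀ a : Fin k,
        ContMDiffAt (𝓡 k) 𝓘(ℝ, ℝ) ∞ (fun q => φ.1 q a) (ρ.1 0) := by
      intro a
      have h1 : ContMDiffAt (𝓡 k) (𝓡 k) ∞ φ.1 (ρ.1 0) :=
        contMDiffAt_of_mem_maximalAtlas φ.2 hs
      have h2 : ContMDiffAt 𝓘(ℝ, E k) 𝓘(ℝ, ℝ) ∞ (fun z : E k => z a) (φ.1 (ρ.1 0)) :=
        ((EuclideanSpace.proj (𝕜 := ℝ) a).contDiff (n := ∞)).contDiffAt.contMDiffAt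
      exact ContMDiffAt.comp _ h2 h1
    have h1 := fun a => h.2 _ (hsm a) 1 (Or.inl rfl)
    have h2 := fun a => h.2 _ (hsm a) 2 (Or.inr rfl)
    simp only [h1, h2]
  · rfl

/-- The local chart `(x, y⁽¹⁾, y⁽²⁾)` of `Osc²M` over the domain of the chart `φ` of `M`
(used only on `π²⁻¹` of that domain). -/
def Osc2.coords (φ : Chart k M) (w : Osc2 k M) : OscC k :=
  Quotient.lift (s := contact k M) (curveCoords φ) (curveCoords_congr φ) w

variable (k M)

/-- A d-vector field `X^α` on `Osc²M` with the points `y⁽¹⁾ = 0` removed: in every chart a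
system of smooth component functions of `(x, y⁽¹⁾, y⁽²⁾)`, which a change of coordinates
transforms with the matrix `∂x̃^α/∂x^β`. -/
structure DVectorField where
  /-- the components in a chart, as functions of the coordinates of `Osc²M` -/
  comp : Chart k M → OscC k → Fin k → ℝ
  smooth : ∀ (φ : Chart k M) (a : Fin k),
    ContDiffOn ℝ ∞ (fun p => comp φ p a) {p | p.1 ∈ φ.1.target ∧ p.2.1 ≠ 0}
  transform : ∀ (φ ψ : Chart k M) (w : Osc2 k M),
    w.proj ∈ φ.1.source → w.proj ∈ ψ.1.source → (w.coords φ).2.1 ≠ 0 →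
    ∀ a, comp ψ (w.coords ψ) a =
      ∑ b, fderiv ℝ (fun z => ψ.1 (φ.1.symm z)) (w.coords φ).1 (EuclideanSpace.single b 1) a
        * comp φ (w.coords φ) b

/-- A Finsler space: a fundamental function on the tangent bundle, continuous, smooth outside
the null section, positive there, positively homogeneous of degree one in the fibres, and with
positive definite fibre Hessian of `F²`. -/
structure FinslerSpace [IsManifold (𝓡 k) ∞ M] where
  F : TangentBundle (𝓡 k) M → ℝ
  continuous_F : Continuous F
  smooth_F : ContMDiffOn (𝓡 k).tangent 𝓘(ℝ, ℝ) ∞ F {v | v.2 ≠ 0}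
  pos_F : ∀ v : TangentBundle (𝓡 k) M, v.2 ≠ 0 → 0 < F v
  homog_F : ∀ (q : M) (y : TangentSpace (𝓡 k) q) (r : ℝ), 0 < r → F ⟨q, r • y⟩ = r * F ⟨q, y⟩
  posDef_F : ∀ (q : M) (y z : E k), y ≠ 0 → z ≠ 0 →
    0 < fderiv ℝ (fun y' : E k => fderiv ℝ (fun y'' : E k => F ⟨q, y''⟩ ^ 2) y' z) y z

variable {k M}

/-- The fundamental function in a chart, as a function of `(x, y⁽¹⁾, y⁽²⁾)` that does not
depend on `y⁽²⁾`. -/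
def FinslerSpace.loc [IsManifold (𝓡 k) ∞ M] (F : FinslerSpace k M) (φ : Chart k M)
    (p : OscC k) : ℝ :=
  F.F ⟨φ.1.symm p.1, mfderiv (𝓡 k) (𝓡 k) φ.1.symm p.1 p.2.1⟩

end Manifolds

/-! ## Nonlinear connections and N-linear connections in coordinates -/

section Connections

variable {k : ℕ}

/-- The dual coefficients `M₍₁₎ᵃ_b`, `M₍₂₎ᵃ_b` of a nonlinear connection. -/
structure NonlinConn (k : ℕ) where
  M1 : Fin k → Fin k → OscC k → ℝ
  M2 : Fin k → Fin k → OscC k → ℝ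

/-- The adapted cobasis: `dxᵃ`, `δy⁽¹⁾ᵃ = dy⁽¹⁾ᵃ + M₍₁₎ᵃ_b dxᵇ`,
`δy⁽²⁾ᵃ = dy⁽²⁾ᵃ + M₍₁₎ᵃ_b dy⁽¹⁾ᵇ + M₍₂₎ᵃ_b dxᵇ`, at `p`, evaluated on the vector `V`. -/
def NonlinConn.cobasis (N : NonlinConn k) (j : Fin 3) (a : Fin k) (p V : OscC k) : ℝ :=
  match j with
  | 0 => V.1 a
  | 1 => V.2.1 a + ∑ b, N.M1 a b p * V.1 b
  | 2 => V.2.2 a + ∑ b, N.M1 a b p * V.2.1 b + ∑ b, N.M2 a b p * V.1 b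

/-- The coefficients `N₍₂₎ᵃ_b = M₍₂₎ᵃ_b - M₍₁₎ᵃ_d M₍₁₎ᵈ_b` (and `N₍₁₎ = M₍₁₎`). -/
def NonlinConn.N2 (N : NonlinConn k) (a b : Fin k) (p : OscC k) : ℝ :=
  N.M2 a b p - ∑ d, N.M1 a d p * N.M1 d b p

/-- The adapted basis, dual to the adapted cobasis:
`δ_a = ∂/∂xᵃ - N₍₁₎ᵇ_a ∂/∂y⁽¹⁾ᵇ - N₍₂₎ᵇ_a ∂/∂y⁽²⁾ᵇ`,
`δ_{1a} = ∂/∂y⁽¹⁾ᵃ - N₍₁₎ᵇ_a ∂/∂y⁽²⁾ᵇ`, `δ_{2a} = ∂/∂y⁽²⁾ᵃ`. -/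
def NonlinConn.delta (N : NonlinConn k) (j : Fin 3) (a : Fin k) (p : OscC k) : OscC k :=
  match j with
  | 0 => coordVec 0 a - ∑ b, N.M1 b a p • coordVec 1 b - ∑ b, N.N2 b a p • coordVec 2 b
  | 1 => coordVec 1 a - ∑ b, N.M1 b a p • coordVec 2 b
  | 2 => coordVec 2 a


/-- The derivative `δ_{ja} f`. -/
def NonlinConn.dd (N : NonlinConn k) (j : Fin 3) (a : Fin k) (f : OscC k → ℝ)
    (p : OscC k) : ℝ :=
  fderiv ℝ f p (N.delta j a p)

/-- The coefficients of the Lie brackets of the adapted basis: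
`[δ_{jb}, δ_{lc}] = ∑_r bracket j l r a b c • δ_{ra}` (summed over `a` too). -/
def NonlinConn.bracket (N : NonlinConn k) (j l r : Fin 3) (a b c : Fin k) (p : OscC k) : ℝ :=
  N.cobasis r a p (VectorField.lieBracket ℝ (N.delta j b) (N.delta l c) p)

/-- The nine coefficients of an N-linear connection: `H i 0 a b c = L₍ᵢ₀₎ᵃ_{bc}` and
`H i j a b c = C₍ᵢⱼ₎ᵃ_{bc}` for `j = 1, 2`. The connection is
`D_{δ_{jc}} δ_{ib} = H i j a b c • δ_{ia}`. -/
abbrev LinCoeffs (k : ℕ) : Type :=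
  Fin 3 → Fin 3 → Fin k → Fin k → Fin k → OscC k → ℝ

variable (N : NonlinConn k) (H : LinCoeffs k)

/-- The covariant derivatives of a d-vector field: `X^α|_{iβ}`, `X^α|⁽¹⁾_{iβ}`, `X^α|⁽²⁾_{iβ}`
for `j = 0, 1, 2`. -/
def covVec (i j : Fin 3) (X : Fin k → OscC k → ℝ) (a b : Fin k) (p : OscC k) : ℝ :=
  N.dd j b (X a) p + ∑ s, H i j a s b p * X s p

/-- The covariant derivatives of a d-tensor field of type `(1,1)`: `T^α_β|_{iγ}`,
`T^α_β|⁽¹⁾_{iγ}`, `T^α_β|⁽²⁾_{iγ}` for `j = 0, 1, 2`. -/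
def covTen (i j : Fin 3) (T : Fin k → Fin k → OscC k → ℝ) (a b c : Fin k) (p : OscC k) : ℝ :=
  N.dd j c (T a b) p + ∑ s, H i j a s c p * T s b p - ∑ s, H i j s b c p * T a s p

/-- The connection 1-forms `ω₍ᵢ₎ᵃ_b = L₍ᵢ₀₎ᵃ_{bd} dxᵈ + C₍ᵢ₁₎ᵃ_{bd} δy⁽¹⁾ᵈ + C₍ᵢ₂₎ᵃ_{bd} δy⁽²⁾ᵈ`,
at `p`, evaluated on the vector `V`. -/
def connForm (i : Fin 3) (a b : Fin k) (p V : OscC k) : ℝ :=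
  ∑ j, ∑ d, H i j a b d p * N.cobasis j d p V

/-- `(D₍ᵢ₎)_V Zᵃ = dZᵃ(V) + Zᵇ ω₍ᵢ₎ᵃ_b(V)`. -/
def covAlong (i : Fin 3) (V : OscC k → OscC k) (Z : Fin k → OscC k → ℝ) (a : Fin k)
    (p : OscC k) : ℝ :=
  fderiv ℝ (Z a) p (V p) + ∑ b, Z b p * connForm N H i a b p (V p)

/-- The curvature `D_V D_W Z - D_W D_V Z - D_{[V,W]} Z` of the N-linear connection on the `i`-th
of the three distributions, for `Z = Zᵃ δ_{ia}`. -/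
def curvature (i : Fin 3) (V W : OscC k → OscC k) (Z : Fin k → OscC k → ℝ) (a : Fin k)
    (p : OscC k) : ℝ :=
  covAlong N H i V (covAlong N H i W Z) a p - covAlong N H i W (covAlong N H i V Z) a p
    - covAlong N H i (VectorField.lieBracket ℝ V W) Z a p

/-- The torsion `D_V W - D_W V - [V, W]` of the operator `D₍ᵢ₎`, which acts with the same forms
`ω₍ᵢ₎` on the components in each of the three distributions; its component in the `r`-th. -/
def torsion (i r : Fin 3) (V W : OscC k → OscC k) (a : Fin k) (p : OscC k) : ℝ :=
  covAlong N H i V (fun b q => N.cobasis r b q (W q)) a p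
    - covAlong N H i W (fun b q => N.cobasis r b q (V q)) a p
    - N.cobasis r a p (VectorField.lieBracket ℝ V W p)

/-- The components of the curvature:
`R(δ_{lc}, δ_{jb}) δ_{id} = curvComp i j l d a b c • δ_{ia}`. -/
def curvComp (i j l : Fin 3) (d a b c : Fin k) (p : OscC k) : ℝ :=
  curvature N H i (N.delta l c) (N.delta j b) (fun s _ => if s = d then 1 else 0) a p

/-- The curvature d-tensor `R₍₀ᵢ₎_dᵃ_{bc}`. -/
def curvR (i : Fin 3) (d a b c : Fin k) (p : OscC k) : ℝ := curvComp N H i 0 0 d a b c p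

/-- The curvature d-tensors `P₍ₗᵢ₎_dᵃ_{bc}`, `l = 1, 2`. -/
def curvP (l i : Fin 3) (d a b c : Fin k) (p : OscC k) : ℝ := curvComp N H i 0 l d a b c p

/-- The curvature d-tensor `Q₍₂ᵢ₎_dᵃ_{bc}`. -/
def curvQ (i : Fin 3) (d a b c : Fin k) (p : OscC k) : ℝ := curvComp N H i 1 2 d a b c p

/-- The curvature d-tensors `S₍ⱼᵢ₎_dᵃ_{bc}`, `j = 1, 2`. -/
def curvS (j i : Fin 3) (d a b c : Fin k) (p : OscC k) : ℝ := curvComp N H i j j d a b c p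

/-- `R₍ⱼᵣ₎ᵃ_{bc}`: the `δ_{ra}`-component of `[δ_{jb}, δ_{jc}]`. -/
def torR (j r : Fin 3) (a b c : Fin k) (p : OscC k) : ℝ := N.bracket j j r a b c p

/-- `P₍ₗᵣ₎ᵃ_{bc}`, `l ≠ r`: the `δ_{ra}`-component of `[δ_b, δ_{lc}]`. -/
def torPmix (l r : Fin 3) (a b c : Fin k) (p : OscC k) : ℝ := N.bracket 0 l r a b c p

/-- `T₍₀₎⁽ⁱ⁾ᵃ_{bc}`: the horizontal component of the torsion of `D₍ᵢ₎` on `(δ_c, δ_b)`. -/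
def torT (i : Fin 3) (a b c : Fin k) (p : OscC k) : ℝ :=
  torsion N H i 0 (N.delta 0 c) (N.delta 0 b) a p

/-- `P₍ₗₗ₎⁽ⁱ⁾ᵃ_{bc}`: the `l`-th component of the torsion of `D₍ᵢ₎` on `(δ_{lc}, δ_b)`. -/
def torP (l i : Fin 3) (a b c : Fin k) (p : OscC k) : ℝ :=
  torsion N H i l (N.delta l c) (N.delta 0 b) a p

/-- `Q₍₂₂₎⁽ⁱ⁾ᵃ_{bc}`: the second vertical component of the torsion of `D₍ᵢ₎` on
`(δ_{2c}, δ_{1b})`. -/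
def torQ (i : Fin 3) (a b c : Fin k) (p : OscC k) : ℝ :=
  torsion N H i 2 (N.delta 2 c) (N.delta 1 b) a p

/-- `S₍ⱼ₎⁽ⁱ⁾ᵃ_{bc}`: the `j`-th component of the torsion of `D₍ᵢ₎` on `(δ_{jc}, δ_{jb})`. -/
def torS (j i : Fin 3) (a b c : Fin k) (p : OscC k) : ℝ :=
  torsion N H i j (N.delta j c) (N.delta j b) a p

end Connections

/-! ## The canonical objects of a Finsler space, in coordinates

`F` is the fundamental function as a function of `(x, y⁽¹⁾, y⁽²⁾)`, independent of `y⁽²⁾`. -/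

section Finsler

variable {n : ℕ} (F : OscC n → ℝ)

/-- The fundamental tensor `g_{ab} = ½ ∂²F²/∂y⁽¹⁾ᵃ∂y⁽¹⁾ᵇ`. -/
def metric (a b : Fin n) (p : OscC n) : ℝ :=
  (1 / 2) * pd 1 a (pd 1 b (fun q => F q ^ 2)) p

/-- The inverse matrix `gᵃᵇ`. -/
def metricInv (a b : Fin n) (p : OscC n) : ℝ :=
  (Matrix.of fun c d => metric F c d p)⁻¹ a b

/-- The Christoffel symbols `γᵃ_{bc}(x, y⁽¹⁾)`. -/
def christoffel (a b c : Fin n) (p : OscC n) : ℝ :=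
  (1 / 2) * ∑ d, metricInv F a d p *
    (pd 0 b (metric F d c) p + pd 0 c (metric F b d) p - pd 0 d (metric F b c) p)

/-- `Gᵃ = ½ γᵃ_{bc} y⁽¹⁾ᵇ y⁽¹⁾ᶜ`. -/
def spray (a : Fin n) (p : OscC n) : ℝ :=
  (1 / 2) * ∑ b, ∑ c, christoffel F a b c p * p.2.1 b * p.2.1 c

/-- `Γ = y⁽¹⁾ᵃ ∂/∂xᵃ + 2 y⁽²⁾ᵃ ∂/∂y⁽¹⁾ᵃ`. -/
def Gam (f : OscC n → ℝ) (p : OscC n) : ℝ :=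
  ∑ a, p.2.1 a * pd 0 a f p + 2 * ∑ a, p.2.2 a * pd 1 a f p

/-- The nonlinear connection determined by the fundamental tensor: `M₍₁₎ᵃ_b = ∂Gᵃ/∂y⁽¹⁾ᵇ`,
`M₍₂₎ᵃ_b = ½ (Γ M₍₁₎ᵃ_b + M₍₁₎ᵃ_d M₍₁₎ᵈ_b)`. -/
def finslerConn : NonlinConn n where
  M1 a b := pd 1 b (spray F a)
  M2 a b p := (1 / 2) * (Gam (pd 1 b (spray F a)) p
    + ∑ d, pd 1 d (spray F a) p * pd 1 b (spray F d) p)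

/-- The functions `B₍ⱼⱼ₎ᵃ_{bc}`, `j = 1, 2`: the `δ_{ja}`-component of `[δ_b, δ_{jc}]`. -/
def berwald (j : Fin 3) (a b c : Fin n) (p : OscC n) : ℝ :=
  (finslerConn F).bracket 0 j j a b c p

/-- The coefficients of the canonical metrical N-linear connection. The first case gives
`L₍₀₀₎`, `C₍₁₁₎`, `C₍₂₂₎`, the second `L₍₁₀₎`, `L₍₂₀₎`, the third `C₍₀₁₎`, `C₍₂₁₎`, `C₍₀₂₎`,
`C₍₁₂₎`. -/
def canonicalConn : LinCoeffs n := fun i j a b c p =>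
  if i = j then
    (1 / 2) * ∑ d, metricInv F a d p *
      ((finslerConn F).dd i b (metric F d c) p + (finslerConn F).dd i c (metric F b d) p
        - (finslerConn F).dd i d (metric F b c) p)
  else if j = 0 then
    berwald F i a c b p + (1 / 2) * ∑ d, metricInv F a d p *
      ((finslerConn F).dd 0 c (metric F b d) p - ∑ f, berwald F i f c b p * metric F f d p
        - ∑ f, berwald F i f c d p * metric F b f p)
  else
    (1 / 2) * ∑ d, metricInv F a d p * (finslerConn F).dd j c (metric F b d) p

end Finsler

/-! ## Objects induced on the submanifold, in coordinates

`x` is the immersion in coordinates, `x^a = x^a(u¹, …, uᵐ)`. -/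

section Submanifold

variable {m n : ℕ} (x : E m → E n) (F : OscC n → ℝ)

/-- `y⁽¹⁾ᵃ = ∂xᵃ/∂u^α v⁽¹⁾^α`. -/
def oscY1 (p : OscC m) : E n := fderiv ℝ x p.1 p.2.1

/-- `Osc²i` in coordinates, with
`2y⁽²⁾ᵃ = ∂y⁽¹⁾ᵃ/∂u^α v⁽¹⁾^α + 2 ∂y⁽¹⁾ᵃ/∂v⁽¹⁾^α v⁽²⁾^α`. -/
def oscMap (p : OscC m) : OscC n :=
  (x p.1, oscY1 x p,
    (1 / 2 : ℝ) • (fderiv ℝ (oscY1 x) p (p.2.1, 0, 0)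
      + (2 : ℝ) • fderiv ℝ (oscY1 x) p (0, p.2.2, 0)))

/-- `B^a_α = ∂xᵃ/∂u^α`. -/
def tanB (a : Fin n) (α : Fin m) : OscC m → ℝ := pd 0 α (fun p => x p.1 a)

/-- A moving frame along `Osc²M̌` over the set `D`: normal fields `B^a_ᾱ`, orthonormal and
orthogonal to the tangent fields `B^a_α`, with the dual frame `B^α_a`, `B^ᾱ_a`. (No regularity of
the normal fields is required.) -/
structure MovingFrame (D : Set (OscC m)) where
  /-- `B^a_ᾱ` -/
  nor : Fin n → Fin (n - m) → OscC m → ℝ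
  /-- `B^α_a` -/
  cotan : Fin m → Fin n → OscC m → ℝ
  /-- `B^ᾱ_a` -/
  conor : Fin (n - m) → Fin n → OscC m → ℝ
  orth : ∀ p ∈ D, ∀ α β,
    ∑ a, ∑ b, metric F a b (oscMap x p) * tanB x a α p * nor b β p = 0
  unit : ∀ p ∈ D, ∀ α β,
    ∑ a, ∑ b, metric F a b (oscMap x p) * nor a α p * nor b β p = if α = β then 1 else 0
  dual_tt : ∀ p ∈ D, ∀ α β, ∑ a, tanB x a β p * cotan α a p = if α = β then 1 else 0
  dual_tn : ∀ p ∈ D, ∀ α β, ∑ a, tanB x a β p * conor α a p = 0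
  dual_nt : ∀ p ∈ D, ∀ α β, ∑ a, cotan α a p * nor a β p = 0
  dual_nn : ∀ p ∈ D, ∀ α β, ∑ a, conor α a p * nor a β p = if α = β then 1 else 0

variable {x F} {D : Set (OscC m)}

namespace MovingFrame

variable (B : MovingFrame x F D)

/-- The coefficient of `du^β` in the 1-form `δy⁽ʲ⁾ᵃ` pulled back by `Osc²i`. -/
def duCoeff (_B : MovingFrame x F D) (j : Fin 3) (a : Fin n) (β : Fin m) (p : OscC m) : ℝ :=
  (finslerConn F).cobasis j a (oscMap x p) (fderiv ℝ (oscMap x) p (coordVec 0 β))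

/-- The induced nonlinear connection, given by `δv⁽ʲ⁾^α = B^α_a δy⁽ʲ⁾ᵃ`, `j = 1, 2`: its dual
coefficients are the coefficients of `du^β` in these forms. -/
def inducedConn : NonlinConn m where
  M1 α β p := ∑ a, B.cotan α a p * B.duCoeff 1 a β p
  M2 α β p := ∑ a, B.cotan α a p * B.duCoeff 2 a β p

/-- `K₍₁₎^ᾱ_β`: `δy⁽¹⁾ᵃ = B^a_α δv⁽¹⁾^α + B^a_ᾱ K₍₁₎^ᾱ_β du^β`. -/
def K1 (α : Fin (n - m)) (β : Fin m) (p : OscC m) : ℝ :=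
  ∑ a, B.conor α a p * B.duCoeff 1 a β p

/-- `K₍₂₎^ᾱ_β`: `δy⁽²⁾ᵃ = B^a_α δv⁽²⁾^α + B^a_ᾱ K₍₁₎^ᾱ_β δv⁽¹⁾^β + B^a_ᾱ K₍₂₎^ᾱ_β du^β`. -/
def K2 (α : Fin (n - m)) (β : Fin m) (p : OscC m) : ℝ :=
  ∑ a, B.conor α a p * B.duCoeff 2 a β p - ∑ γ, B.K1 α γ p * B.inducedConn.M1 γ β p

/-- The coupling of the canonical metrical N-linear connection to the induced nonlinear
connection: `Ľ₍ᵢ₀₎ᵃ_{bδ}`, `Č₍ᵢ₁₎ᵃ_{bδ}`, `Č₍ᵢ₂₎ᵃ_{bδ}` for `j = 0, 1, 2`. -/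
def coupling (i j : Fin 3) (a b : Fin n) (δ : Fin m) (p : OscC m) : ℝ :=
  match j with
  | 0 => ∑ d, (canonicalConn F i 0 a b d (oscMap x p) * tanB x d δ p
      + canonicalConn F i 1 a b d (oscMap x p) * ∑ ν, B.nor d ν p * B.K1 ν δ p
      + canonicalConn F i 2 a b d (oscMap x p) * ∑ ν, B.nor d ν p * B.K2 ν δ p)
  | 1 => ∑ d, (canonicalConn F i 1 a b d (oscMap x p) * tanB x d δ p
      + canonicalConn F i 2 a b d (oscMap x p) * ∑ ν, B.nor d ν p * B.K1 ν δ p)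
  | 2 => ∑ d, canonicalConn F i 2 a b d (oscMap x p) * tanB x d δ p

/-- The induced tangent N-linear connection:
`L₍ᵢ₀₎^α_{βδ} = B^α_d (B^d_{βδ} + B^f_β Ľ₍ᵢ₀₎ᵈ_{fδ})` with `B^d_{βδ} = ∂²xᵈ/∂u^β∂u^δ`, and
`C₍ᵢⱼ₎^α_{βδ} = B^α_d B^f_β Č₍ᵢⱼ₎ᵈ_{fδ}`. -/
def tangentConn : LinCoeffs m := fun i j α β δ p =>
  ∑ d, B.cotan α d p *
    ((if j = 0 then pd 0 δ (tanB x d β) p else 0)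
      + ∑ f, tanB x f β p * B.coupling i j d f δ p)

end MovingFrame

end Submanifold

end OscRicci

end

open OscRicci

/-!
The identities are the Ricci identities of a linear connection, written in the frame adapted to the
induced nonlinear connection. For any nonlinear connection with differentiable coefficients, any
differentiable coefficients `H` of an N-linear connection and any `C²` components `X`, expanding two
iterated covariant derivatives in the directions `δ_{jβ}`, `δ_{lγ}` and antisymmetrizing leaves
three kinds of terms: the curvature applied to `X`, the derivative of `X` along the Lie bracket
`[δ_{lγ}, δ_{jβ}]` (second derivatives of `X` cancel by symmetry), and the two terms in which `H`
acts on the index of the inner derivative (`ricci_identity`). The bracket is expanded in the adapted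
frame. A torsion component is a difference of two coefficients `H` minus a bracket component
(`torsion_delta`), so the last two kinds of terms combine to the torsion terms of the theorem; the
bracket components that do not occur there vanish since the adapted frame is triangular with
constant diagonal (`NonlinConn.bracket_zero`, `NonlinConn.bracket_vertical_one`,
`NonlinConn.bracket_two_two`). This is `ricci_identities`.

What remains is regularity: the induced nonlinear connection and the induced tangent connection must
be smooth on `D`, or the derivatives above would be meaningless.
* In a chart, `F` is smooth where `y⁽¹⁾ ≠ 0` (`FinslerSpace.contDiffOn_loc`), and its fibre Hessian
  is the Hessian of `F²` on the tangent space transported by the differential of the chart, hence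
  positive definite (`FinslerSpace.metric_pos`). So `g` is invertible there and the canonical
  connection, a rational expression in `g` and its derivatives, is smooth
  (`contDiffOn_canonicalConn`).
* The immersion carries `v⁽¹⁾ ≠ 0` to `y⁽¹⁾ ≠ 0` (`MovingFrame.oscY1_ne_zero`).
* No regularity of the normals is assumed, but they enter only through two tensors that do not
  depend on their choice: the tangential coframe `B^α_a`, which orthogonality expresses through `g`
  and `B^a_α` (`MovingFrame.cotan_eq`), and the normal projection `B^a_ν B^ν_b`, complementary to
  the tangential one (`MovingFrame.completeness`). Both are smooth, hence so are the induced objects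
  (`MovingFrame.contDiffOn_tangentConn`).
-/

noncomputable section

namespace OscRicci

/-! ### The adapted basis and its dual -/

section AdaptedBasis

variable {k : ℕ} (N : NonlinConn k)

theorem NonlinConn.delta_zero (a : Fin k) (p : OscC k) :
    N.delta 0 a p = (EuclideanSpace.single a 1, WithLp.toLp 2 fun b => -N.M1 b a p,
      WithLp.toLp 2 fun b => -N.N2 b a p) := by
  ext c <;> simp [NonlinConn.delta, coordVec, Prod.fst_sum, Prod.snd_sum, Pi.single_apply]

theorem NonlinConn.delta_one (a : Fin k) (p : OscC k) :
    N.delta 1 a p = (0, EuclideanSpace.single a 1, WithLp.toLp 2 fun b => -N.M1 b a p) := by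
  ext c <;> simp [NonlinConn.delta, coordVec, Prod.fst_sum, Prod.snd_sum, Pi.single_apply]

theorem NonlinConn.delta_two (a : Fin k) (p : OscC k) :
    N.delta 2 a p = (0, 0, EuclideanSpace.single a 1) := rfl

theorem NonlinConn.cobasis_delta (r j : Fin 3) (a b : Fin k) (p : OscC k) :
    N.cobasis r a p (N.delta j b p) = if r = j ∧ a = b then 1 else 0 := by
  fin_cases j <;> fin_cases r <;>
    simp [NonlinConn.cobasis, NonlinConn.delta_zero, NonlinConn.delta_one,
      NonlinConn.delta_two, NonlinConn.N2]
  ring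

theorem NonlinConn.sum_cobasis_smul_delta (p V : OscC k) :
    ∑ r, ∑ s, N.cobasis r s p V • N.delta r s p = V := by
  have hM : ∀ c, ∑ s, (∑ b, N.M1 s b p * V.1 b) * N.M1 c s p
      = ∑ s, V.1 s * ∑ d, N.M1 c d p * N.M1 d s p := by
    intro c
    simp only [Finset.sum_mul, Finset.mul_sum]
    rw [Finset.sum_comm]
    exact Finset.sum_congr rfl fun s _ => Finset.sum_congr rfl fun d _ => by ring
  ext c
  · simp [Fin.sum_univ_three, NonlinConn.delta_zero, NonlinConn.delta_one,
      NonlinConn.delta_two, Prod.fst_sum, Pi.single_apply, NonlinConn.cobasis]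
  · simp [Fin.sum_univ_three, NonlinConn.delta_zero, NonlinConn.delta_one,
      NonlinConn.delta_two, Prod.fst_sum, Prod.snd_sum, Pi.single_apply, NonlinConn.cobasis,
      mul_comm]
  · simp only [Fin.sum_univ_three, NonlinConn.delta_zero, NonlinConn.delta_one,
      NonlinConn.delta_two, Prod.snd_sum, NonlinConn.cobasis, NonlinConn.N2,
      Prod.smul_mk, Prod.snd_add, PiLp.add_apply, WithLp.ofLp_sum, Finset.sum_apply,
      WithLp.ofLp_smul, Pi.smul_apply, smul_eq_mul, PiLp.single_apply, add_mul, mul_neg,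
      Finset.sum_add_distrib, mul_sub, Finset.sum_sub_distrib, Finset.sum_neg_distrib, hM,
      mul_ite, mul_one, mul_zero, Finset.sum_ite_eq, Finset.mem_univ, if_true]
    simp only [mul_comm]
    ring

theorem NonlinConn.fderiv_eq_sum_dd (f : OscC k → ℝ) (p V : OscC k) :
    fderiv ℝ f p V = ∑ r, ∑ s, N.cobasis r s p V * N.dd r s f p := by
  conv_lhs => rw [← N.sum_cobasis_smul_delta p V]
  simp [NonlinConn.dd]

theorem NonlinConn.differentiableAt_delta {p : OscC k}
    (h1 : ∀ a b, DifferentiableAt ℝ (N.M1 a b) p) (h2 : ∀ a b, DifferentiableAt ℝ (N.M2 a b) p)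
    (j : Fin 3) (a : Fin k) : DifferentiableAt ℝ (N.delta j a) p := by
  fin_cases j
  · unfold NonlinConn.delta NonlinConn.N2
    fun_prop
  · unfold NonlinConn.delta
    fun_prop
  · exact differentiableAt_const _

end AdaptedBasis

/-! ### Lie brackets of the adapted fields -/

section Bracket

variable {k : ℕ} {N : NonlinConn k}

theorem NonlinConn.bracket_swap (j l r : Fin 3) (a b c : Fin k) (p : OscC k) :
    N.bracket j l r a b c p = -N.bracket l j r a c b p := by
  unfold NonlinConn.bracket
  rw [VectorField.lieBracket_swap]
  fin_cases r <;> simp [NonlinConn.cobasis, Finset.sum_neg_distrib] <;> ring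

/-- A component on which two vector fields are constant vanishes on their Lie bracket. -/
theorem map_lieBracket_eq_zero {E' : Type*} [NormedAddCommGroup E'] [NormedSpace ℝ E']
    {G : Type*} [NormedAddCommGroup G] [NormedSpace ℝ G] (π : E' →L[ℝ] G) {V W : E' → E'}
    {p : E'} {v w : G} (hV : DifferentiableAt ℝ V p) (hW : DifferentiableAt ℝ W p)
    (hv : ∀ q, π (V q) = v) (hw : ∀ q, π (W q) = w) :
    π (VectorField.lieBracket ℝ V W p) = 0 := by
  have key : ∀ {U : E' → E'} {u : G}, DifferentiableAt ℝ U p → (∀ q, π (U q) = u) →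
      ∀ z, π (fderiv ℝ U p z) = 0 := by
    intro U u hU hu z
    have h : fderiv ℝ (fun q => π (U q)) p z = π (fderiv ℝ U p z) :=
      congrArg (· z) (π.hasFDerivAt.comp p hU.hasFDerivAt).fderiv
    have hc : (fun q => π (U q)) = fun _ => u := funext hu
    rw [hc] at h
    simpa using h.symm
  rw [VectorField.lieBracket_eq]
  simp [key hV hv, key hW hw]

variable {p : OscC k} (hδ : ∀ j a, DifferentiableAt ℝ (N.delta j a) p)
include hδ

theorem NonlinConn.lieBracket_delta_fst (j l : Fin 3) (b c : Fin k) :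
    (VectorField.lieBracket ℝ (N.delta j b) (N.delta l c) p).1 = 0 := by
  have h : ∀ j b, ∃ v, ∀ q, (ContinuousLinearMap.fst ℝ (E k) (E k × E k)) (N.delta j b q) = v := by
    intro j b
    fin_cases j
    exacts [⟨_, fun q => by simp [N.delta_zero]; rfl⟩, ⟨_, fun q => by simp [N.delta_one]; rfl⟩,
      ⟨_, fun q => by simp [N.delta_two]; rfl⟩]
  exact map_lieBracket_eq_zero (ContinuousLinearMap.fst ℝ (E k) (E k × E k)) (hδ j b) (hδ l c)
    (h j b).choose_spec (h l c).choose_spec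

/-- The forms `dxᵃ` are closed, so a bracket of adapted fields has no horizontal component. -/
theorem NonlinConn.bracket_zero (j l : Fin 3) (a b c : Fin k) :
    N.bracket j l 0 a b c p = 0 := by
  simp [NonlinConn.bracket, NonlinConn.cobasis, NonlinConn.lieBracket_delta_fst hδ]

/-- The vertical fields `δ_{1a}`, `δ_{2a}` have constant components along `∂/∂y⁽¹⁾`, so their
brackets are multiples of the `δ_{2a}`. -/
theorem NonlinConn.bracket_vertical_one {j l : Fin 3} (hj : j ≠ 0) (hl : l ≠ 0)
    (a b c : Fin k) : N.bracket j l 1 a b c p = 0 := by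
  have h : ∀ j : Fin 3, j ≠ 0 → ∀ b, ∃ v, ∀ q,
      ((ContinuousLinearMap.fst ℝ (E k) (E k)).comp
        (ContinuousLinearMap.snd ℝ (E k) (E k × E k))) (N.delta j b q) = v := by
    intro j hj b
    fin_cases j
    · exact absurd rfl hj
    exacts [⟨_, fun q => by simp [N.delta_one]; rfl⟩, ⟨_, fun q => by simp [N.delta_two]; rfl⟩]
  have h0 := map_lieBracket_eq_zero ((ContinuousLinearMap.fst ℝ (E k) (E k)).comp
      (ContinuousLinearMap.snd ℝ (E k) (E k × E k))) (hδ j b) (hδ l c)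
      (h j hj b).choose_spec (h l hl c).choose_spec
  simp only [ContinuousLinearMap.comp_apply, ContinuousLinearMap.coe_snd',
    ContinuousLinearMap.coe_fst'] at h0
  simp [NonlinConn.bracket, NonlinConn.cobasis, h0, NonlinConn.lieBracket_delta_fst hδ]

omit hδ in
theorem NonlinConn.bracket_two_two (r : Fin 3) (a b c : Fin k) :
    N.bracket 2 2 r a b c p = 0 := by
  have h : VectorField.lieBracket ℝ (N.delta 2 b) (N.delta 2 c) p = 0 := by
    have : ∀ b, N.delta 2 b = fun _ => coordVec 2 b := fun b => rfl
    simp [VectorField.lieBracket_eq, this]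
  fin_cases r <;> simp [NonlinConn.bracket, NonlinConn.cobasis, h]

end Bracket

/-! ### The Ricci identities of an N-linear connection -/

section RicciIdentity

variable {k : ℕ} (N : NonlinConn k) (H : LinCoeffs k)

theorem connForm_delta (i j : Fin 3) (a b c : Fin k) (p : OscC k) :
    connForm N H i a b p (N.delta j c p) = H i j a b c p := by
  simp [connForm, N.cobasis_delta, ite_and]

theorem torsion_delta (i r j l : Fin 3) (a b c : Fin k) (p : OscC k) :
    torsion N H i r (N.delta l c) (N.delta j b) a p
      = (if r = j then H i l a b c p else 0) - (if r = l then H i j a c b p else 0)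
        - N.bracket l j r a c b p := by
  simp only [torsion, covAlong, N.cobasis_delta, connForm_delta, NonlinConn.bracket]
  simp [ite_and]

theorem curvComp_eq (i j l : Fin 3) (d a b c : Fin k) (p : OscC k) :
    curvComp N H i j l d a b c p
      = (N.dd l c (H i j a d b) p + ∑ s, H i j s d b p * H i l a s c p)
        - (N.dd j b (H i l a d c) p + ∑ s, H i l s d c p * H i j a s b p)
        - ∑ r, ∑ s, H i r a d s p * N.bracket l j r s c b p := by
  have h : ∀ j b, covAlong N H i (N.delta j b) (fun s _ => if s = d then 1 else 0)
      = fun a q => H i j a d b q := by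
    intro j b
    funext a q
    simp [covAlong, connForm_delta]
  have h' : ∀ V : OscC k → OscC k, covAlong N H i V (fun s _ => if s = d then 1 else 0) a p
      = connForm N H i a d p (V p) := by
    intro V
    simp [covAlong]
  simp only [curvComp, curvature, h, h']
  simp only [covAlong, connForm_delta]
  simp only [connForm, NonlinConn.dd, NonlinConn.bracket]

/-- By symmetry of the second derivative, the commutator of two adapted derivatives is the
derivative along the Lie bracket of the adapted fields, which need not commute. -/
theorem dd_dd_sub {f : OscC k → ℝ} {p : OscC k} (hf : ContDiffAt ℝ 2 f p)
    (hδ : ∀ j a, DifferentiableAt ℝ (N.delta j a) p) (j l : Fin 3) (b c : Fin k) :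
    N.dd l c (N.dd j b f) p - N.dd j b (N.dd l c f) p
      = ∑ r, ∑ s, N.bracket l j r s c b p * N.dd r s f p := by
  have hdf : DifferentiableAt ℝ (fderiv ℝ f) p :=
    (hf.fderiv_right (m := 1) (by norm_num)).differentiableAt one_ne_zero
  have h : ∀ j b V, fderiv ℝ (N.dd j b f) p V
      = fderiv ℝ (fderiv ℝ f) p V (N.delta j b p) + fderiv ℝ f p (fderiv ℝ (N.delta j b) p V) := by
    intro j b V
    have := (hdf.hasFDerivAt.clm_apply (hδ j b).hasFDerivAt).fderiv
    change fderiv ℝ (fun q => fderiv ℝ f q (N.delta j b q)) p V = _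
    rw [this]
    simp [add_comm]
  have hsymm : IsSymmSndFDerivAt ℝ f p := hf.isSymmSndFDerivAt (by simp)
  have := N.fderiv_eq_sum_dd f p (VectorField.lieBracket ℝ (N.delta l c) (N.delta j b) p)
  simp only [NonlinConn.bracket]
  rw [← this, VectorField.lieBracket_eq, map_sub]
  change fderiv ℝ (N.dd j b f) p (N.delta l c p) - fderiv ℝ (N.dd l c f) p (N.delta j b p) = _
  rw [h, h, hsymm.eq (N.delta l c p) (N.delta j b p)]
  ring

/-- The Ricci identity for an arbitrary pair of adapted directions. The bracket terms come from the
commutator of the derivatives, the last two sums from the lower index of the first covariant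
derivative. -/
theorem ricci_identity {X : Fin k → OscC k → ℝ} {p : OscC k} (hX : ∀ a, ContDiffAt ℝ 2 (X a) p)
    (hH : ∀ i j a b c, DifferentiableAt ℝ (H i j a b c) p)
    (hδ : ∀ j a, DifferentiableAt ℝ (N.delta j a) p) (i j l : Fin 3) (a b c : Fin k) :
    covTen N H i l (covVec N H i j X) a b c p - covTen N H i j (covVec N H i l X) a c b p
      = ∑ d, X d p * curvComp N H i j l d a b c p
        + ∑ r, ∑ s, N.bracket l j r s c b p * covVec N H i r X a s p
        - ∑ s, H i l s b c p * covVec N H i j X a s p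
        + ∑ s, H i j s c b p * covVec N H i l X a s p := by
  have hXd : ∀ a, DifferentiableAt ℝ (X a) p := fun a => (hX a).differentiableAt two_ne_zero
  have hdd : ∀ j b, DifferentiableAt ℝ (N.dd j b (X a)) p := fun j b =>
    (((hX a).fderiv_right (m := 1) (by norm_num)).differentiableAt one_ne_zero).clm_apply (hδ j b)
  have h : ∀ j b l c, N.dd l c (covVec N H i j X a b) p = N.dd l c (N.dd j b (X a)) p
      + ∑ s, (N.dd l c (H i j a s b) p * X s p + H i j a s b p * N.dd l c (X s) p) := by
    intro j b l c
    have hm : ∀ s ∈ Finset.univ, DifferentiableAt ℝ (fun q => H i j a s b q * X s q) p :=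
      fun s _ => (hH i j a s b).mul (hXd s)
    change fderiv ℝ (fun q => N.dd j b (X a) q + ∑ s, H i j a s b q * X s q) p (N.delta l c p)
      = fderiv ℝ (N.dd j b (X a)) p (N.delta l c p)
        + ∑ s, (fderiv ℝ (H i j a s b) p (N.delta l c p) * X s p
          + H i j a s b p * fderiv ℝ (X s) p (N.delta l c p))
    rw [fderiv_fun_add (hdd j b) (DifferentiableAt.fun_sum hm), fderiv_fun_sum hm]
    simp only [add_apply, sum_apply]
    congr 1
    refine Finset.sum_congr rfl fun s _ => ?_
    rw [fderiv_fun_mul (hH i j a s b) (hXd s)]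
    simp only [add_apply, smul_apply, smul_eq_mul]
    ring
  have hs := dd_dd_sub N (hX a) hδ j l b c
  have hbr : ∑ r, ∑ s, N.bracket l j r s c b p * covVec N H i r X a s p
      = (N.dd l c (N.dd j b (X a)) p - N.dd j b (N.dd l c (X a)) p)
        + ∑ d, X d p * ∑ r, ∑ s, H i r a d s p * N.bracket l j r s c b p := by
    rw [hs]
    simp only [covVec, mul_add, Finset.sum_add_distrib, Finset.mul_sum]
    congr 1
    rw [Finset.sum_comm]
    conv_rhs => rw [Finset.sum_comm]
    rw [Finset.sum_comm]
    refine Finset.sum_congr rfl fun r _ => ?_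
    conv_rhs => rw [Finset.sum_comm]
    exact Finset.sum_congr rfl fun s _ => Finset.sum_congr rfl fun d _ => by ring
  have hHH : ∀ j b l c, ∑ s, H i l a s c p * covVec N H i j X s b p
      = ∑ s, H i l a s c p * N.dd j b (X s) p
        + ∑ d, X d p * ∑ s, H i j s d b p * H i l a s c p := by
    intro j b l c
    simp only [covVec, mul_add, Finset.sum_add_distrib, Finset.mul_sum]
    congr 1
    rw [Finset.sum_comm]
    exact Finset.sum_congr rfl fun s _ => Finset.sum_congr rfl fun d _ => by ring
  have hc : ∀ j b l c, ∑ s, N.dd l c (H i j a s b) p * X s p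
      = ∑ s, X s p * N.dd l c (H i j a s b) p := fun j b l c =>
    Finset.sum_congr rfl fun s _ => mul_comm _ _
  rw [hbr]
  simp only [covTen, h, curvComp_eq, hHH, mul_sub, mul_add, Finset.sum_sub_distrib,
    Finset.sum_add_distrib, hc]
  ring

/-- The six identities hold for every N-linear connection with differentiable coefficients: in
each of them the torsion coefficients are those of the general identity, and the remaining bracket
components vanish because of the triangular shape of the adapted basis. -/
theorem ricci_identities {X : Fin k → OscC k → ℝ} {p : OscC k}
    (hX : ∀ a, ContDiffAt ℝ 2 (X a) p)
    (hH : ∀ i j a b c, DifferentiableAt ℝ (H i j a b c) p)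
    (hδ : ∀ j a, DifferentiableAt ℝ (N.delta j a) p) (i : Fin 3) (α β γ : Fin k) :
    (covTen N H i 0 (covVec N H i 0 X) α β γ p - covTen N H i 0 (covVec N H i 0 X) α γ β p
      = ∑ δ, X δ p * curvR N H i δ α β γ p
        - ∑ σ, torT N H i σ β γ p * covVec N H i 0 X α σ p
        - ∑ σ, torR N 0 1 σ β γ p * covVec N H i 1 X α σ p
        - ∑ σ, torR N 0 2 σ β γ p * covVec N H i 2 X α σ p) ∧
    (covTen N H i 1 (covVec N H i 0 X) α β γ p - covTen N H i 0 (covVec N H i 1 X) α γ β p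
      = ∑ δ, X δ p * curvP N H 1 i δ α β γ p
        - ∑ σ, H i 1 σ β γ p * covVec N H i 0 X α σ p
        - ∑ σ, torP N H 1 i σ β γ p * covVec N H i 1 X α σ p
        - ∑ σ, torPmix N 1 2 σ β γ p * covVec N H i 2 X α σ p) ∧
    (covTen N H i 2 (covVec N H i 0 X) α β γ p - covTen N H i 0 (covVec N H i 2 X) α γ β p
      = ∑ δ, X δ p * curvP N H 2 i δ α β γ p
        - ∑ σ, H i 2 σ β γ p * covVec N H i 0 X α σ p
        - ∑ σ, torPmix N 2 1 σ β γ p * covVec N H i 1 X α σ p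
        - ∑ σ, torP N H 2 i σ β γ p * covVec N H i 2 X α σ p) ∧
    (covTen N H i 2 (covVec N H i 1 X) α β γ p - covTen N H i 1 (covVec N H i 2 X) α γ β p
      = ∑ δ, X δ p * curvQ N H i δ α β γ p
        - ∑ σ, H i 2 σ β γ p * covVec N H i 1 X α σ p
        - ∑ σ, torQ N H i σ β γ p * covVec N H i 2 X α σ p) ∧
    (∀ j : Fin 3, j = 1 ∨ j = 2 →
      covTen N H i j (covVec N H i j X) α β γ p - covTen N H i j (covVec N H i j X) α γ β p
      = ∑ δ, X δ p * curvS N H j i δ α β γ p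
        - ∑ σ, torS N H j i σ β γ p * covVec N H i j X α σ p
        - ∑ σ, torR N j 2 σ β γ p * covVec N H i 2 X α σ p) ∧
    torR N 2 2 α β γ p = 0 := by
  refine ⟨?_, ?_, ?_, ?_, ?_, N.bracket_two_two 2 α β γ⟩
  · rw [ricci_identity N H hX hH hδ]
    simp only [torT, torR, curvR, torsion_delta, Fin.sum_univ_three, N.bracket_swap 0 0 _ _ β γ,
      if_true, sub_mul, neg_mul, Finset.sum_sub_distrib, Finset.sum_neg_distrib]
    ring
  · rw [ricci_identity N H hX hH hδ]
    simp only [torP, torPmix, curvP, torsion_delta, Fin.sum_univ_three,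
      N.bracket_swap 0 1 _ _ β γ, N.bracket_zero hδ]
    simp [sub_mul]
    ring
  · rw [ricci_identity N H hX hH hδ]
    simp only [torP, torPmix, curvP, torsion_delta, Fin.sum_univ_three,
      N.bracket_swap 0 2 _ _ β γ, N.bracket_zero hδ]
    simp [sub_mul]
    ring
  · rw [ricci_identity N H hX hH hδ]
    simp only [torQ, curvQ, torsion_delta, Fin.sum_univ_three, N.bracket_zero hδ,
      N.bracket_vertical_one hδ (show (2 : Fin 3) ≠ 0 by decide) (show (1 : Fin 3) ≠ 0 by decide)]
    simp [sub_mul]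
    ring
  · rintro j (rfl | rfl) <;> rw [ricci_identity N H hX hH hδ]
    · simp only [torS, torR, curvS, torsion_delta, Fin.sum_univ_three, N.bracket_zero hδ,
        N.bracket_swap 1 1 2 _ β γ,
        N.bracket_vertical_one hδ (show (1 : Fin 3) ≠ 0 by decide) (show (1 : Fin 3) ≠ 0 by decide)]
      simp [sub_mul]
      ring
    · simp only [torS, torR, curvS, torsion_delta, Fin.sum_univ_three, N.bracket_two_two]
      simp [sub_mul]
      ring

end RicciIdentity

/-! ### Smoothness on open sets of coordinates -/

section Smooth

variable {E' G : Type*} [NormedAddCommGroup E'] [NormedSpace ℝ E'] [NormedAddCommGroup G]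
  [NormedSpace ℝ G] {U : Set E'}

theorem contDiffOn_fderiv_apply (hU : IsOpen U) {f : E' → G} (hf : ContDiffOn ℝ ∞ f U)
    {V : E' → E'} (hV : ContDiffOn ℝ ∞ V U) :
    ContDiffOn ℝ ∞ (fun p => fderiv ℝ f p (V p)) U :=
  (hf.fderiv_of_isOpen hU (by simp)).clm_apply hV

theorem contDiffOn_lieBracket (hU : IsOpen U) {V W : E' → E'} (hV : ContDiffOn ℝ ∞ V U)
    (hW : ContDiffOn ℝ ∞ W U) : ContDiffOn ℝ ∞ (VectorField.lieBracket ℝ V W) U :=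
  (contDiffOn_fderiv_apply hU hW hV).sub (contDiffOn_fderiv_apply hU hV hW)

theorem contDiffOn_matrix_det {ι : Type*} [Fintype ι] [DecidableEq ι] {A : E' → Matrix ι ι ℝ}
    (hA : ∀ a b, ContDiffOn ℝ ∞ (fun p => A p a b) U) :
    ContDiffOn ℝ ∞ (fun p => (A p).det) U := by
  simp only [Matrix.det_apply']
  exact ContDiffOn.sum fun s _ => contDiffOn_const.mul (contDiffOn_prod fun a _ => hA _ _)

theorem contDiffOn_matrix_inv {ι : Type*} [Fintype ι] [DecidableEq ι] {A : E' → Matrix ι ι ℝ}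
    (hA : ∀ a b, ContDiffOn ℝ ∞ (fun p => A p a b) U) (hdet : ∀ p ∈ U, (A p).det ≠ 0) (a b : ι) :
    ContDiffOn ℝ ∞ (fun p => (A p)⁻¹ a b) U := by
  simp only [Matrix.inv_def, Ring.inverse_eq_inv', Matrix.smul_apply, smul_eq_mul,
    Matrix.adjugate_apply]
  refine ((contDiffOn_matrix_det hA).inv hdet).mul (contDiffOn_matrix_det fun c d => ?_)
  by_cases h : c = b
  · subst h
    simpa using contDiffOn_const
  · simpa [Matrix.updateRow_ne h] using hA c d

/-- `Matrix.PosDef` is avoided because it asks for symmetry, which invertibility does not need. -/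
theorem det_ne_zero_of_forall_pos {ι : Type*} [Fintype ι] [DecidableEq ι] {A : Matrix ι ι ℝ}
    (hA : ∀ z : ι → ℝ, z ≠ 0 → 0 < z ⬝ᵥ A.mulVec z) : A.det ≠ 0 := by
  intro h
  obtain ⟨v, hv, hv0⟩ := Matrix.exists_mulVec_eq_zero_iff.2 h
  exact (hA v hv).ne' (by rw [hv0, dotProduct_zero])

end Smooth

section SmoothConn

variable {k : ℕ} {U : Set (OscC k)}

theorem contDiffOn_pd (hU : IsOpen U) {f : OscC k → ℝ} (hf : ContDiffOn ℝ ∞ f U) (j : Fin 3)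
    (a : Fin k) : ContDiffOn ℝ ∞ (pd j a f) U :=
  contDiffOn_fderiv_apply hU hf contDiffOn_const

theorem contDiffOn_cobasis {E' : Type*} [NormedAddCommGroup E'] [NormedSpace ℝ E'] {D : Set E'}
    {N : NonlinConn k} {q V : E' → OscC k} (hV : ContDiffOn ℝ ∞ V D)
    (h1 : ∀ a b, ContDiffOn ℝ ∞ (fun p => N.M1 a b (q p)) D)
    (h2 : ∀ a b, ContDiffOn ℝ ∞ (fun p => N.M2 a b (q p)) D) (j : Fin 3) (a : Fin k) :
    ContDiffOn ℝ ∞ (fun p => N.cobasis j a (q p) (V p)) D := by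
  have c0 : ∀ a, ContDiffOn ℝ ∞ (fun p => (V p).1 a) D := fun a =>
    (EuclideanSpace.proj (𝕜 := ℝ) a).contDiff.comp_contDiffOn hV.fst
  have c1 : ∀ a, ContDiffOn ℝ ∞ (fun p => (V p).2.1 a) D := fun a =>
    (EuclideanSpace.proj (𝕜 := ℝ) a).contDiff.comp_contDiffOn hV.snd.fst
  have c2 : ∀ a, ContDiffOn ℝ ∞ (fun p => (V p).2.2 a) D := fun a =>
    (EuclideanSpace.proj (𝕜 := ℝ) a).contDiff.comp_contDiffOn hV.snd.snd
  fin_cases j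
  · exact c0 a
  · exact (c1 a).add (ContDiffOn.sum fun b _ => (h1 a b).mul (c0 b))
  · exact ((c2 a).add (ContDiffOn.sum fun b _ => (h1 a b).mul (c1 b))).add
      (ContDiffOn.sum fun b _ => (h2 a b).mul (c0 b))

variable {N : NonlinConn k} (h1 : ∀ a b, ContDiffOn ℝ ∞ (N.M1 a b) U)
  (h2 : ∀ a b, ContDiffOn ℝ ∞ (N.M2 a b) U)
include h1 h2

theorem contDiffOn_delta (j : Fin 3) (a : Fin k) : ContDiffOn ℝ ∞ (N.delta j a) U := by
  fin_cases j
  · exact (contDiffOn_const.sub (ContDiffOn.sum fun b _ => (h1 b a).smul contDiffOn_const)).sub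
      (ContDiffOn.sum fun b _ => ((h2 b a).sub
        (ContDiffOn.sum fun d _ => (h1 b d).mul (h1 d a))).smul contDiffOn_const)
  · exact contDiffOn_const.sub (ContDiffOn.sum fun b _ => (h1 b a).smul contDiffOn_const)
  · exact contDiffOn_const

theorem contDiffOn_dd (hU : IsOpen U) {f : OscC k → ℝ} (hf : ContDiffOn ℝ ∞ f U) (j : Fin 3)
    (a : Fin k) : ContDiffOn ℝ ∞ (N.dd j a f) U :=
  contDiffOn_fderiv_apply hU hf (contDiffOn_delta h1 h2 j a)

theorem contDiffOn_bracket (hU : IsOpen U) (j l r : Fin 3) (a b c : Fin k) :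
    ContDiffOn ℝ ∞ (N.bracket j l r a b c) U :=
  contDiffOn_cobasis (q := id) (contDiffOn_lieBracket hU (contDiffOn_delta h1 h2 j b)
    (contDiffOn_delta h1 h2 l c)) h1 h2 r a

end SmoothConn

/-! ### The canonical connection of a Finsler space is smooth -/

section FinslerCoords

variable {n : ℕ} {F : OscC n → ℝ} {U : Set (OscC n)} (hU : IsOpen U)
  (hF : ContDiffOn ℝ ∞ F U)
include hU hF

theorem contDiffOn_metric (a b : Fin n) : ContDiffOn ℝ ∞ (metric F a b) U :=
  contDiffOn_const.mul (contDiffOn_pd hU (contDiffOn_pd hU (hF.pow 2) 1 b) 1 a)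

variable (hdet : ∀ p ∈ U, (Matrix.of fun c d => metric F c d p).det ≠ 0)
include hdet

theorem contDiffOn_metricInv (a b : Fin n) : ContDiffOn ℝ ∞ (metricInv F a b) U :=
  contDiffOn_matrix_inv (fun c d => contDiffOn_metric hU hF c d) hdet a b

theorem contDiffOn_spray (a : Fin n) : ContDiffOn ℝ ∞ (spray F a) U := by
  have hy : ∀ b, ContDiffOn ℝ ∞ (fun p : OscC n => p.2.1 b) U := fun b =>
    ((EuclideanSpace.proj (𝕜 := ℝ) b).contDiff.comp (contDiff_fst.comp contDiff_snd)).contDiffOn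
  have hg : ∀ j a b c, ContDiffOn ℝ ∞ (pd j a (metric F b c)) U := fun j a b c =>
    contDiffOn_pd hU (contDiffOn_metric hU hF b c) j a
  have hγ : ∀ a b c, ContDiffOn ℝ ∞ (christoffel F a b c) U := fun a b c =>
    contDiffOn_const.mul (ContDiffOn.sum fun d _ => (contDiffOn_metricInv hU hF hdet a d).mul
      (((hg 0 b d c).add (hg 0 c b d)).sub (hg 0 d b c)))
  exact contDiffOn_const.mul (ContDiffOn.sum fun b _ => ContDiffOn.sum fun c _ =>
    ((hγ a b c).mul (hy b)).mul (hy c))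

theorem contDiffOn_finslerConn_M1 (a b : Fin n) : ContDiffOn ℝ ∞ ((finslerConn F).M1 a b) U :=
  contDiffOn_pd hU (contDiffOn_spray hU hF hdet a) 1 b

theorem contDiffOn_finslerConn_M2 (a b : Fin n) :
    ContDiffOn ℝ ∞ ((finslerConn F).M2 a b) U := by
  have hM := contDiffOn_finslerConn_M1 hU hF hdet
  have hy1 : ∀ b, ContDiffOn ℝ ∞ (fun p : OscC n => p.2.1 b) U := fun b =>
    ((EuclideanSpace.proj (𝕜 := ℝ) b).contDiff.comp (contDiff_fst.comp contDiff_snd)).contDiffOn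
  have hy2 : ∀ b, ContDiffOn ℝ ∞ (fun p : OscC n => p.2.2 b) U := fun b =>
    ((EuclideanSpace.proj (𝕜 := ℝ) b).contDiff.comp (contDiff_snd.comp contDiff_snd)).contDiffOn
  refine contDiffOn_const.mul (ContDiffOn.add ?_ (ContDiffOn.sum fun d _ => (hM a d).mul (hM d b)))
  exact (ContDiffOn.sum fun c _ => (hy1 c).mul (contDiffOn_pd hU (hM a b) 0 c)).add
    (contDiffOn_const.mul (ContDiffOn.sum fun c _ =>
      (hy2 c).mul (contDiffOn_pd hU (hM a b) 1 c)))

theorem contDiffOn_canonicalConn (i j : Fin 3) (a b c : Fin n) :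
    ContDiffOn ℝ ∞ (canonicalConn F i j a b c) U := by
  have h1 := contDiffOn_finslerConn_M1 hU hF hdet
  have h2 := contDiffOn_finslerConn_M2 hU hF hdet
  have hg := contDiffOn_metric hU hF
  have hgi := contDiffOn_metricInv hU hF hdet
  have hdg : ∀ j a b c, ContDiffOn ℝ ∞ ((finslerConn F).dd j a (metric F b c)) U :=
    fun j a b c => contDiffOn_dd h1 h2 hU (hg b c) j a
  have hB : ∀ j a b c, ContDiffOn ℝ ∞ (berwald F j a b c) U := fun j a b c =>
    contDiffOn_bracket h1 h2 hU 0 j j a b c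
  unfold canonicalConn
  split_ifs
  · exact contDiffOn_const.mul (ContDiffOn.sum fun d _ => (hgi a d).mul
      (((hdg i b d c).add (hdg i c b d)).sub (hdg i d b c)))
  · exact (hB i a c b).add (contDiffOn_const.mul (ContDiffOn.sum fun d _ => (hgi a d).mul
      (((hdg 0 c b d).sub (ContDiffOn.sum fun f _ => (hB i f c b).mul (hg f d))).sub
        (ContDiffOn.sum fun f _ => (hB i f c d).mul (hg b f)))))
  · exact contDiffOn_const.mul (ContDiffOn.sum fun d _ => (hgi a d).mul (hdg j c b d))

end FinslerCoords

/-! ### The fundamental function and tensor in a chart -/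

section FinslerChart

variable {n : ℕ} {M : Type*} [TopologicalSpace M] [ChartedSpace (E n) M] [IsManifold (𝓡 n) ∞ M]
  (F : FinslerSpace n M) (φ : Chart n M)

/-- The coordinates of the points with `y⁽¹⁾ ≠ 0` over the domain of `φ`. -/
def slitDomain (φ : Chart n M) : Set (OscC n) := {p | p.1 ∈ φ.1.target ∧ p.2.1 ≠ 0}

omit [IsManifold (𝓡 n) ∞ M] in
theorem isOpen_slitDomain : IsOpen (slitDomain φ) :=
  (φ.1.open_target.preimage continuous_fst).inter
    (isOpen_ne.preimage (continuous_fst.comp continuous_snd))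

omit [IsManifold (𝓡 n) ∞ M] in
theorem Chart.exists_mfderiv_symm {x : E n} (hx : x ∈ φ.1.target) :
    ∃ e : E n ≃L[ℝ] E n, ∀ y : E n, e y = mfderiv (𝓡 n) (𝓡 n) φ.1.symm x y := by
  have hd : φ.1.MDifferentiable (𝓡 n) (𝓡 n) :=
    ⟨(contMDiffOn_of_mem_maximalAtlas φ.2).mdifferentiableOn (by simp),
      (contMDiffOn_symm_of_mem_maximalAtlas φ.2).mdifferentiableOn (by simp)⟩
  exact ⟨hd.symm.mfderiv hx, fun y => rfl⟩

theorem FinslerSpace.contDiffOn_loc : ContDiffOn ℝ ∞ (F.loc φ) (slitDomain φ) := by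
  have h1 := (contMDiffOn_symm_of_mem_maximalAtlas φ.2).contMDiffOn_tangentMapWithin (m := ∞)
    (by simp) φ.1.open_target.uniqueMDiffOn
  have h2 : ContMDiff 𝓘(ℝ, OscC n) (𝓡 n).tangent ∞
      (fun p : OscC n => (⟨p.1, p.2.1⟩ : TangentBundle (𝓡 n) (E n))) := by
    intro p
    refine (Bundle.contMDiffAt_totalSpace).2 ⟨contDiff_fst.contMDiff.contMDiffAt, ?_⟩
    have : ContMDiff 𝓘(ℝ, OscC n) (𝓡 n) ∞ (fun p : OscC n => p.2.1) :=
      (contDiff_fst.comp contDiff_snd).contMDiff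
    exact this.contMDiffAt.congr_of_eventuallyEq (Filter.Eventually.of_forall fun q => by simp)
  have h3 := F.smooth_F.comp (h1.comp h2.contMDiffOn (s := slitDomain φ) fun p hp => hp.1) ?_
  · refine contMDiffOn_iff_contDiffOn.1 (h3.congr fun p hp => ?_)
    simp only [Function.comp, tangentMapWithin, FinslerSpace.loc]
    rw [mfderivWithin_of_isOpen φ.1.open_target hp.1]
  · intro p hp
    obtain ⟨e, he⟩ := φ.exists_mfderiv_symm hp.1
    change mfderivWithin (𝓡 n) (𝓡 n) φ.1.symm φ.1.target p.1 p.2.1 ≠ 0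
    rw [mfderivWithin_of_isOpen φ.1.open_target hp.1, ← he]
    exact (map_ne_zero_iff e e.injective).2 hp.2

theorem fderiv_apply_fibre {G : OscC n → ℝ} {p : OscC n} (hG : DifferentiableAt ℝ G p) (z : E n) :
    fderiv ℝ G p (0, z, 0) = fderiv ℝ (fun y => G (p.1, y, p.2.2)) p.2.1 z := by
  have h : HasFDerivAt (fun y : E n => ((p.1, y, p.2.2) : OscC n))
      ((0 : E n →L[ℝ] E n).prod ((ContinuousLinearMap.id ℝ (E n)).prod 0)) p.2.1 :=
    (hasFDerivAt_const _ _).prodMk ((hasFDerivAt_id _).prodMk (hasFDerivAt_const _ _))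
  exact (congrArg (· z) (hG.hasFDerivAt.comp
    (f := fun y : E n => ((p.1, y, p.2.2) : OscC n)) p.2.1 h).fderiv).symm

/-- The fibre derivative of `F²` in a chart is the fibre derivative of `F²` on the tangent space,
transported by the differential of the chart, so `g` is positive definite in coordinates. -/
theorem FinslerSpace.metric_pos {p : OscC n} (hp : p ∈ slitDomain φ) {z : Fin n → ℝ}
    (hz : z ≠ 0) :
    0 < z ⬝ᵥ (Matrix.of fun a b => metric (F.loc φ) a b p).mulVec z := by
  set G : OscC n → ℝ := fun q => F.loc φ q ^ 2 with hGdef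
  set ζ : E n := WithLp.toLp 2 z with hζ
  have hU := isOpen_slitDomain φ
  have hG : ContDiffOn ℝ ∞ G (slitDomain φ) := (F.contDiffOn_loc φ).pow 2
  have hdiff : ∀ {f : OscC n → ℝ}, ContDiffOn ℝ ∞ f (slitDomain φ) → ∀ q ∈ slitDomain φ,
      DifferentiableAt ℝ f q := fun hf q hq =>
    (hf.contDiffAt (hU.mem_nhds hq)).differentiableAt (by simp)
  have hvec : ((0, ζ, 0) : OscC n) = ∑ a, z a • coordVec 1 a := by
    ext c <;> simp [coordVec, Prod.fst_sum, Prod.snd_sum, Pi.single_apply, hζ]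
  have hdir : ∀ f : OscC n → ℝ, ∀ q, fderiv ℝ f q (0, ζ, 0) = ∑ a, z a * pd 1 a f q := by
    intro f q
    rw [hvec]
    simp [pd]
  -- the quadratic form of `g` is half the second derivative of `F²` in the direction `z`
  have hquad : z ⬝ᵥ (Matrix.of fun a b => metric (F.loc φ) a b p).mulVec z
      = (1 / 2) * fderiv ℝ (fun q => fderiv ℝ G q (0, ζ, 0)) p (0, ζ, 0) := by
    rw [hdir, Finset.mul_sum]
    simp only [dotProduct, Matrix.mulVec, Matrix.of_apply]
    refine Finset.sum_congr rfl fun a _ => ?_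
    have hd : ∀ b ∈ Finset.univ, DifferentiableAt ℝ (fun q => z b * pd 1 b G q) p := fun b _ =>
      (hdiff (contDiffOn_pd hU hG 1 b) p hp).const_mul _
    have : pd 1 a (fun q => fderiv ℝ G q (0, ζ, 0)) p = ∑ b, z b * pd 1 a (pd 1 b G) p := by
      simp only [hdir]
      change fderiv ℝ (fun q => ∑ b, z b * pd 1 b G q) p (coordVec 1 a)
        = ∑ b, z b * fderiv ℝ (pd 1 b G) p (coordVec 1 a)
      rw [fderiv_fun_sum hd]
      simp only [sum_apply]
      refine Finset.sum_congr rfl fun b _ => ?_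
      rw [fderiv_const_mul (hdiff (contDiffOn_pd hU hG 1 b) p hp)]
      rfl
    rw [this, Finset.mul_sum, Finset.mul_sum, Finset.mul_sum]
    refine Finset.sum_congr rfl fun b _ => ?_
    simp only [metric, ← hGdef]
    ring
  obtain ⟨e, he⟩ := φ.exists_mfderiv_symm hp.1
  set κ : E n → ℝ := fun y => F.F ⟨φ.1.symm p.1, y⟩ ^ 2
  have hκ : (fun y => G (p.1, y, p.2.2)) = κ ∘ e := by
    funext y
    simp only [hGdef, FinslerSpace.loc, Function.comp, κ, he]
  have hfib : ∀ y : E n, y ≠ 0 →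
      fderiv ℝ G (p.1, y, p.2.2) (0, ζ, 0) = fderiv ℝ κ (e y) (e ζ) := by
    intro y hy
    rw [fderiv_apply_fibre (hdiff hG (p.1, y, p.2.2) ⟨hp.1, hy⟩)]
    simp only [hκ]
    rw [e.comp_right_fderiv]
    rfl
  have hsecond : fderiv ℝ (fun q => fderiv ℝ G q (0, ζ, 0)) p (0, ζ, 0)
      = fderiv ℝ (fun y' => fderiv ℝ κ y' (e ζ)) (e p.2.1) (e ζ) := by
    rw [fderiv_apply_fibre
      (hdiff (contDiffOn_fderiv_apply hU hG (contDiffOn_const (c := (0, ζ, 0)))) p hp)]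
    have hev : (fun y => fderiv ℝ G (p.1, y, p.2.2) (0, ζ, 0))
        =ᶠ[nhds p.2.1] (fun y' => fderiv ℝ κ y' (e ζ)) ∘ e := by
      filter_upwards [isOpen_ne.mem_nhds hp.2] with y hy using hfib y hy
    rw [hev.fderiv_eq, e.comp_right_fderiv]
    rfl
  have hζ0 : ζ ≠ 0 := fun h => hz (by simpa [hζ] using h)
  rw [hquad, hsecond]
  exact mul_pos (by norm_num) (F.posDef_F _ _ _ ((map_ne_zero_iff e e.injective).2 hp.2)
    ((map_ne_zero_iff e e.injective).2 hζ0))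

end FinslerChart

/-! ### The induced objects on the submanifold are smooth -/

section Frame

variable {m n : ℕ} {x : E m → E n} {F : OscC n → ℝ} {D : Set (OscC m)}

/-- The dual frames have complementary ranks `m` and `n - m`, so the duality relations make the
frame and the coframe inverse square matrices on both sides. -/
theorem MovingFrame.completeness (B : MovingFrame x F D) (hmn : m ≤ n) {p : OscC m} (hp : p ∈ D) :
    (Matrix.of fun a α => tanB x a α p) * (Matrix.of fun α a => B.cotan α a p)
      + (Matrix.of fun a ν => B.nor a ν p) * (Matrix.of fun ν a => B.conor ν a p) = 1 := by
  rw [← Matrix.fromCols_mul_fromRows]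
  refine (Matrix.mul_eq_one_comm_of_equiv
    ((finSumFinEquiv.trans (finCongr (Nat.add_sub_of_le hmn))).symm)).2 ?_
  rw [Matrix.fromRows_mul_fromCols, ← Matrix.fromBlocks_one]
  congr 1 <;> ext α β
  · simpa [Matrix.mul_apply, Matrix.one_apply, mul_comm, eq_comm] using B.dual_tt p hp α β
  · simpa [Matrix.mul_apply] using B.dual_nt p hp α β
  · simpa [Matrix.mul_apply, mul_comm] using B.dual_tn p hp α β
  · simpa [Matrix.mul_apply, Matrix.one_apply] using B.dual_nn p hp α β

/-- The matrix `g_{ab} B^a_α B^b_β` of the induced metric. -/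
def gram (x : E m → E n) (F : OscC n → ℝ) (p : OscC m) : Matrix (Fin m) (Fin m) ℝ :=
  (Matrix.of fun a α => tanB x a α p).transpose
    * (Matrix.of fun a b => metric F a b (oscMap x p)) * (Matrix.of fun a α => tanB x a α p)

theorem MovingFrame.gram_det_ne_zero (B : MovingFrame x F D) {p : OscC m} (hp : p ∈ D)
    (hpos : ∀ z : Fin n → ℝ, z ≠ 0 →
      0 < z ⬝ᵥ (Matrix.of fun a b => metric F a b (oscMap x p)).mulVec z) :
    (gram x F p).det ≠ 0 := by
  refine det_ne_zero_of_forall_pos fun z hz => ?_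
  have hCT : (Matrix.of fun α a => B.cotan α a p) * (Matrix.of fun a α => tanB x a α p) = 1 := by
    ext α β
    simpa [Matrix.mul_apply, Matrix.one_apply, mul_comm, eq_comm] using B.dual_tt p hp α β
  have hTz : (Matrix.of fun a α => tanB x a α p).mulVec z ≠ 0 := by
    intro h
    apply hz
    rw [← Matrix.one_mulVec z, ← hCT, ← Matrix.mulVec_mulVec, h, Matrix.mulVec_zero]
  have := hpos _ hTz
  rwa [gram, ← Matrix.mulVec_mulVec, ← Matrix.mulVec_mulVec, Matrix.dotProduct_mulVec,
    Matrix.vecMul_transpose]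

/-- Orthogonality determines the coframe: `B^α_a = g^{αβ} g_{ba} B^b_β`, where `g^{αβ}` is the
inverse of the induced metric. In particular it does not depend on the choice of normals. -/
theorem MovingFrame.cotan_eq (B : MovingFrame x F D) (hmn : m ≤ n) {p : OscC m} (hp : p ∈ D)
    (hdet : (gram x F p).det ≠ 0) (α : Fin m) (a : Fin n) :
    B.cotan α a p
      = ∑ β, (gram x F p)⁻¹ α β * ∑ b, tanB x b β p * metric F b a (oscMap x p) := by
  set T : Matrix (Fin n) (Fin m) ℝ := Matrix.of fun a α => tanB x a α p with hT
  set g : Matrix (Fin n) (Fin n) ℝ := Matrix.of fun a b => metric F a b (oscMap x p) with hg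
  set C : Matrix (Fin m) (Fin n) ℝ := Matrix.of fun α a => B.cotan α a p with hC
  set V : Matrix (Fin n) (Fin (n - m)) ℝ := Matrix.of fun a ν => B.nor a ν p with hV
  have horth : T.transpose * g * V = 0 := by
    ext β ν
    rw [Matrix.zero_apply, ← B.orth p hp β ν, Finset.sum_comm]
    simp only [Matrix.mul_apply, Finset.sum_mul, hT, hg, hV, Matrix.transpose_apply,
      Matrix.of_apply]
    exact Finset.sum_congr rfl fun b _ => Finset.sum_congr rfl fun c _ => by ring
  have h : T.transpose * g = gram x F p * C := by
    have := congrArg (fun A => T.transpose * g * A) (B.completeness hmn hp)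
    simp only [← Matrix.mul_assoc, Matrix.mul_add, Matrix.mul_one] at this
    rw [← hT, ← hV, ← hC, horth, Matrix.zero_mul, add_zero] at this
    exact this.symm
  have h2 : C = (gram x F p)⁻¹ * (T.transpose * g) := by
    rw [h, ← Matrix.mul_assoc, Matrix.nonsing_inv_mul _ (isUnit_iff_ne_zero.2 hdet), Matrix.one_mul]
  have h3 := congrFun (congrFun h2 α) a
  simpa [Matrix.mul_apply, hC, hT, hg] using h3

end Frame

section Induced

variable {m n : ℕ} {x : E m → E n} {F : OscC n → ℝ} {D : Set (OscC m)} {W : Set (E m)}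
  (hD : IsOpen D) (hW : IsOpen W) (hx : ContDiffOn ℝ ∞ x W) (hDW : ∀ p ∈ D, p.1 ∈ W)
include hD hW hx hDW

omit hD in
theorem contDiffOn_oscY1 : ContDiffOn ℝ ∞ (oscY1 x) D :=
  ((hx.fderiv_of_isOpen hW (by simp)).comp contDiff_fst.contDiffOn hDW).clm_apply
    (contDiff_fst.comp contDiff_snd).contDiffOn

theorem contDiffOn_oscMap : ContDiffOn ℝ ∞ (oscMap x) D := by
  have hy := contDiffOn_oscY1 hW hx hDW
  have h1 : ContDiff ℝ ∞ (fun p : OscC m => ((p.2.1, 0, 0) : OscC m)) := by fun_prop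
  have h2 : ContDiff ℝ ∞ (fun p : OscC m => ((0, p.2.2, 0) : OscC m)) := by fun_prop
  exact (hx.comp contDiff_fst.contDiffOn hDW).prodMk (hy.prodMk (ContDiffOn.const_smul (1 / 2 : ℝ)
    ((contDiffOn_fderiv_apply hD hy h1.contDiffOn).add
      ((contDiffOn_fderiv_apply hD hy h2.contDiffOn).const_smul (2 : ℝ)))))

omit hW in
theorem contDiffOn_tanB (a : Fin n) (α : Fin m) : ContDiffOn ℝ ∞ (tanB x a α) D :=
  contDiffOn_pd hD ((EuclideanSpace.proj (𝕜 := ℝ) a).contDiff.comp_contDiffOn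
    (hx.comp contDiff_fst.contDiffOn hDW)) 0 α

variable {U : Set (OscC n)} (hU : IsOpen U) (hF : ContDiffOn ℝ ∞ F U)
  (hpos : ∀ q ∈ U, ∀ z : Fin n → ℝ, z ≠ 0 →
    0 < z ⬝ᵥ (Matrix.of fun a b => metric F a b q).mulVec z)
  (hmaps : Set.MapsTo (oscMap x) D U) (B : MovingFrame x F D) (hmn : m ≤ n)
include hU hF hpos hmaps

theorem MovingFrame.contDiffOn_duCoeff (j : Fin 3) (a : Fin n) (β : Fin m) :
    ContDiffOn ℝ ∞ (B.duCoeff j a β) D := by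
  have ho := contDiffOn_oscMap hD hW hx hDW
  have hdet := fun q hq => det_ne_zero_of_forall_pos (hpos q hq)
  exact contDiffOn_cobasis (contDiffOn_fderiv_apply hD ho contDiffOn_const)
    (fun a b => (contDiffOn_finslerConn_M1 hU hF hdet a b).comp ho hmaps)
    (fun a b => (contDiffOn_finslerConn_M2 hU hF hdet a b).comp ho hmaps) j a

include hmn

theorem MovingFrame.contDiffOn_cotan (α : Fin m) (a : Fin n) :
    ContDiffOn ℝ ∞ (B.cotan α a) D := by
  have ho := contDiffOn_oscMap hD hW hx hDW
  have hT := contDiffOn_tanB hD hx hDW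
  have hg : ∀ a b, ContDiffOn ℝ ∞ (fun p => metric F a b (oscMap x p)) D := fun a b =>
    (contDiffOn_metric hU hF a b).comp ho hmaps
  have hG : ∀ p ∈ D, (gram x F p).det ≠ 0 := fun p hp =>
    B.gram_det_ne_zero hp (hpos _ (hmaps hp))
  have hGs : ∀ α β, ContDiffOn ℝ ∞ (fun p => gram x F p α β) D := by
    intro α β
    simp only [gram, Matrix.mul_apply, Matrix.transpose_apply, Matrix.of_apply]
    exact ContDiffOn.sum fun b _ => (ContDiffOn.sum fun c _ => (hT c α).mul (hg c b)).mul (hT b β)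
  refine ContDiffOn.congr ?_ fun p hp => B.cotan_eq hmn hp (hG p hp) α a
  exact ContDiffOn.sum fun β _ => (contDiffOn_matrix_inv hGs hG α β).mul
    (ContDiffOn.sum fun b _ => (hT b β).mul (hg b a))

theorem MovingFrame.contDiffOn_inducedConn_M1 (α β : Fin m) :
    ContDiffOn ℝ ∞ (B.inducedConn.M1 α β) D := by
  change ContDiffOn ℝ ∞ (fun p => ∑ a, B.cotan α a p * B.duCoeff 1 a β p) D
  exact ContDiffOn.sum fun a _ => (B.contDiffOn_cotan hD hW hx hDW hU hF hpos hmaps hmn α a).mul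
    (B.contDiffOn_duCoeff hD hW hx hDW hU hF hpos hmaps 1 a β)

theorem MovingFrame.contDiffOn_inducedConn_M2 (α β : Fin m) :
    ContDiffOn ℝ ∞ (B.inducedConn.M2 α β) D := by
  change ContDiffOn ℝ ∞ (fun p => ∑ a, B.cotan α a p * B.duCoeff 2 a β p) D
  exact ContDiffOn.sum fun a _ => (B.contDiffOn_cotan hD hW hx hDW hU hF hpos hmaps hmn α a).mul
    (B.contDiffOn_duCoeff hD hW hx hDW hU hF hpos hmaps 2 a β)

/-- The normals need not be smooth, but the normal projection `B^a_ν B^ν_b` is, since it is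
complementary to the tangential one. -/
theorem MovingFrame.contDiffOn_normalProj (a b : Fin n) :
    ContDiffOn ℝ ∞ (fun p => ∑ ν, B.nor a ν p * B.conor ν b p) D := by
  have hC := B.contDiffOn_cotan hD hW hx hDW hU hF hpos hmaps hmn
  have hT := contDiffOn_tanB hD hx hDW
  refine ContDiffOn.congr (f := fun p => (1 : Matrix (Fin n) (Fin n) ℝ) a b
    - ∑ α, tanB x a α p * B.cotan α b p) ?_ fun p hp => ?_
  · exact contDiffOn_const.sub (ContDiffOn.sum fun α _ => (hT a α).mul (hC α b))
  · rw [← B.completeness hmn hp]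
    simp [Matrix.mul_apply]

theorem MovingFrame.contDiffOn_nor_K1 (a : Fin n) (β : Fin m) :
    ContDiffOn ℝ ∞ (fun p => ∑ ν, B.nor a ν p * B.K1 ν β p) D := by
  have hP := B.contDiffOn_normalProj hD hW hx hDW hU hF hpos hmaps hmn
  have hd := B.contDiffOn_duCoeff hD hW hx hDW hU hF hpos hmaps
  refine (ContDiffOn.sum fun b _ => (hP a b).mul (hd 1 b β) : ContDiffOn ℝ ∞ (fun p =>
    ∑ b, (∑ ν, B.nor a ν p * B.conor ν b p) * B.duCoeff 1 b β p) D).congr fun p _ => ?_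
  simp only [MovingFrame.K1, Finset.mul_sum, Finset.sum_mul]
  rw [Finset.sum_comm]
  exact Finset.sum_congr rfl fun b _ => Finset.sum_congr rfl fun ν _ => by ring

theorem MovingFrame.contDiffOn_nor_K2 (a : Fin n) (β : Fin m) :
    ContDiffOn ℝ ∞ (fun p => ∑ ν, B.nor a ν p * B.K2 ν β p) D := by
  have hP := B.contDiffOn_normalProj hD hW hx hDW hU hF hpos hmaps hmn
  have hd := B.contDiffOn_duCoeff hD hW hx hDW hU hF hpos hmaps
  have hK := B.contDiffOn_nor_K1 hD hW hx hDW hU hF hpos hmaps hmn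
  have hM := B.contDiffOn_inducedConn_M1 hD hW hx hDW hU hF hpos hmaps hmn
  refine ((ContDiffOn.sum fun b _ => (hP a b).mul (hd 2 b β)).sub
    (ContDiffOn.sum fun γ _ => (hK a γ).mul (hM γ β)) : ContDiffOn ℝ ∞ (fun p =>
    ∑ b, (∑ ν, B.nor a ν p * B.conor ν b p) * B.duCoeff 2 b β p
      - ∑ γ, (∑ ν, B.nor a ν p * B.K1 ν γ p) * B.inducedConn.M1 γ β p) D).congr fun p _ => ?_
  simp only [MovingFrame.K2, mul_sub, Finset.sum_sub_distrib, Finset.mul_sum, Finset.sum_mul]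
  congr 1 <;> rw [Finset.sum_comm] <;>
    exact Finset.sum_congr rfl fun b _ => Finset.sum_congr rfl fun ν _ => by ring

theorem MovingFrame.contDiffOn_coupling (i j : Fin 3) (a b : Fin n) (δ : Fin m) :
    ContDiffOn ℝ ∞ (B.coupling i j a b δ) D := by
  have ho := contDiffOn_oscMap hD hW hx hDW
  have hdet := fun q hq => det_ne_zero_of_forall_pos (hpos q hq)
  have hT := contDiffOn_tanB hD hx hDW
  have hK1 := B.contDiffOn_nor_K1 hD hW hx hDW hU hF hpos hmaps hmn
  have hK2 := B.contDiffOn_nor_K2 hD hW hx hDW hU hF hpos hmaps hmn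
  have hL : ∀ j d, ContDiffOn ℝ ∞ (fun p => canonicalConn F i j a b d (oscMap x p)) D :=
    fun j d => (contDiffOn_canonicalConn hU hF hdet i j a b d).comp ho hmaps
  fin_cases j
  · exact ContDiffOn.sum fun d _ => (((hL 0 d).mul (hT d δ)).add ((hL 1 d).mul (hK1 d δ))).add
      ((hL 2 d).mul (hK2 d δ))
  · exact ContDiffOn.sum fun d _ => ((hL 1 d).mul (hT d δ)).add ((hL 2 d).mul (hK1 d δ))
  · exact ContDiffOn.sum fun d _ => (hL 2 d).mul (hT d δ)

theorem MovingFrame.contDiffOn_tangentConn (i j : Fin 3) (α β δ : Fin m) :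
    ContDiffOn ℝ ∞ (B.tangentConn i j α β δ) D := by
  have hC := B.contDiffOn_cotan hD hW hx hDW hU hF hpos hmaps hmn
  have hT := contDiffOn_tanB hD hx hDW
  have hL := B.contDiffOn_coupling hD hW hx hDW hU hF hpos hmaps hmn
  refine ContDiffOn.sum fun d _ => (hC α d).mul (ContDiffOn.add ?_
    (ContDiffOn.sum fun f _ => (hT f β).mul (hL i j d f δ)))
  split_ifs
  · exact contDiffOn_pd hD (hT d β) 0 δ
  · exact contDiffOn_const

end Induced

/-- The duality `B^α_a B^a_β = δ^α_β` makes the differential of the immersion injective, so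
`Osc²` of the immersion maps points with `v⁽¹⁾ ≠ 0` to points with `y⁽¹⁾ ≠ 0`. -/
theorem MovingFrame.oscY1_ne_zero {m n : ℕ} {x : E m → E n} {F : OscC n → ℝ} {D : Set (OscC m)}
    (B : MovingFrame x F D) {p : OscC m} (hp : p ∈ D) (hx : DifferentiableAt ℝ x p.1)
    (hv : p.2.1 ≠ 0) : oscY1 x p ≠ 0 := by
  intro h0
  apply hv
  have htan : ∀ a α, tanB x a α p = fderiv ℝ x p.1 (EuclideanSpace.single α 1) a := by
    intro a α
    have h : HasFDerivAt (fun q : OscC m => x q.1 a) _ p :=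
      (EuclideanSpace.proj (𝕜 := ℝ) a).hasFDerivAt.comp p
        (hx.hasFDerivAt.comp p (hasFDerivAt_fst (𝕜 := ℝ) (p := p)))
    simp only [tanB, pd]
    rw [h.fderiv]
    rfl
  have hy : ∀ a, oscY1 x p a = ∑ α, p.2.1 α * tanB x a α p := by
    intro a
    have hv : p.2.1 = ∑ α, p.2.1 α • EuclideanSpace.single α (1 : ℝ) := by
      ext β
      simp [Pi.single_apply]
    simp only [htan, oscY1]
    conv_lhs => rw [hv]
    simp
  ext β
  calc p.2.1 β = ∑ α, p.2.1 α * ∑ a, tanB x a α p * B.cotan β a p := by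
        simp [B.dual_tt p hp]
    _ = ∑ a, B.cotan β a p * oscY1 x p a := by
        simp only [hy, Finset.mul_sum]
        rw [Finset.sum_comm]
        exact Finset.sum_congr rfl fun b _ => Finset.sum_congr rfl fun ν _ => by ring
    _ = (0 : E m) β := by simp [h0]

end OscRicci

end

/-! ### The Ricci identities of the induced tangent connection -/

theorem mainTheorem2 {m n : ℕ} (hm : 1 < m) (hmn : m < n)
    {Mc : Type*} [TopologicalSpace Mc] [ChartedSpace (E m) Mc] [IsManifold (𝓡 m) ∞ Mc]
    {M : Type*} [TopologicalSpace M] [ChartedSpace (E n) M] [IsManifold (𝓡 n) ∞ M]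
    (f : Mc → M) (hf : ContMDiff (𝓡 m) (𝓡 n) ∞ f)
    (himm : ∀ q, Function.Injective (mfderiv (𝓡 m) (𝓡 n) f q))
    (F : FinslerSpace n M)
    -- local charts of the two manifolds, and a moving frame over the common domain
    (φc : Chart m Mc) (φ : Chart n M)
    (D : Set (OscC m))
    (hD : D = {p | p.1 ∈ φc.1.target ∧ f (φc.1.symm p.1) ∈ φ.1.source ∧ p.2.1 ≠ 0})
    (B : MovingFrame (fun u => φ.1 (f (φc.1.symm u))) (F.loc φ) D)
    -- the induced nonlinear connection and the induced tangent N-linear connection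
    (N : NonlinConn m) (hN : N = B.inducedConn)
    (H : LinCoeffs m) (hH : H = B.tangentConn)
    -- a d-vector field and its components
    (Xfield : DVectorField m Mc)
    (X : Fin m → OscC m → ℝ) (hX : X = fun α p => Xfield.comp φc p α) :
    ∀ p ∈ D, ∀ (i : Fin 3) (α β γ : Fin m),
      (covTen N H i 0 (covVec N H i 0 X) α β γ p - covTen N H i 0 (covVec N H i 0 X) α γ β p
        = ∑ δ, X δ p * curvR N H i δ α β γ p
          - ∑ σ, torT N H i σ β γ p * covVec N H i 0 X α σ p
          - ∑ σ, torR N 0 1 σ β γ p * covVec N H i 1 X α σ p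
          - ∑ σ, torR N 0 2 σ β γ p * covVec N H i 2 X α σ p) ∧
      (covTen N H i 1 (covVec N H i 0 X) α β γ p - covTen N H i 0 (covVec N H i 1 X) α γ β p
        = ∑ δ, X δ p * curvP N H 1 i δ α β γ p
          - ∑ σ, H i 1 σ β γ p * covVec N H i 0 X α σ p
          - ∑ σ, torP N H 1 i σ β γ p * covVec N H i 1 X α σ p
          - ∑ σ, torPmix N 1 2 σ β γ p * covVec N H i 2 X α σ p) ∧
      (covTen N H i 2 (covVec N H i 0 X) α β γ p - covTen N H i 0 (covVec N H i 2 X) α γ β p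
        = ∑ δ, X δ p * curvP N H 2 i δ α β γ p
          - ∑ σ, H i 2 σ β γ p * covVec N H i 0 X α σ p
          - ∑ σ, torPmix N 2 1 σ β γ p * covVec N H i 1 X α σ p
          - ∑ σ, torP N H 2 i σ β γ p * covVec N H i 2 X α σ p) ∧
      (covTen N H i 2 (covVec N H i 1 X) α β γ p - covTen N H i 1 (covVec N H i 2 X) α γ β p
        = ∑ δ, X δ p * curvQ N H i δ α β γ p
          - ∑ σ, H i 2 σ β γ p * covVec N H i 1 X α σ p
          - ∑ σ, torQ N H i σ β γ p * covVec N H i 2 X α σ p) ∧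
      (∀ j : Fin 3, j = 1 ∨ j = 2 →
        covTen N H i j (covVec N H i j X) α β γ p - covTen N H i j (covVec N H i j X) α γ β p
        = ∑ δ, X δ p * curvS N H j i δ α β γ p
          - ∑ σ, torS N H j i σ β γ p * covVec N H i j X α σ p
          - ∑ σ, torR N j 2 σ β γ p * covVec N H i 2 X α σ p) ∧
      torR N 2 2 α β γ p = 0 := by
  subst hX hN hH
  have hφc := contMDiffOn_symm_of_mem_maximalAtlas φc.2
  let x : E m → E n := fun u => φ.1 (f (φc.1.symm u))
  let W : Set (E m) := φc.1.target ∩ (f ∘ φc.1.symm) ⁻¹' φ.1.source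
  have hfc : ContMDiffOn (𝓡 m) (𝓡 n) ∞ (f ∘ φc.1.symm) φc.1.target :=
    hf.comp_contMDiffOn hφc
  have hW : IsOpen W := hfc.continuousOn.isOpen_inter_preimage φc.1.open_target φ.1.open_source
  have hx : ContDiffOn ℝ ∞ x W :=
    ((contMDiffOn_of_mem_maximalAtlas φ.2).comp (hfc.mono Set.inter_subset_left)
      fun u hu => hu.2).contDiffOn
  have hDW : ∀ p ∈ D, p.1 ∈ W := by
    rw [hD]
    exact fun p hp => ⟨hp.1, hp.2.1⟩
  have hDopen : IsOpen D := by
    have : D = (Prod.fst ⁻¹' W) ∩ {p | p.2.1 ≠ 0} := by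
      rw [hD]
      ext p
      exact and_assoc.symm
    rw [this]
    exact (hW.preimage continuous_fst).inter
      (isOpen_ne.preimage (continuous_fst.comp continuous_snd))
  have hmaps : Set.MapsTo (oscMap x) D (slitDomain φ) := by
    intro p hp
    have hp1 := hDW p hp
    have hv : p.2.1 ≠ 0 := by
      rw [hD] at hp
      exact hp.2.2
    exact ⟨φ.1.map_source hp1.2, B.oscY1_ne_zero hp
      ((hx.contDiffAt (hW.mem_nhds hp1)).differentiableAt (by simp)) hv⟩
  have hU := isOpen_slitDomain φ
  have hF := F.contDiffOn_loc φ
  have hpos : ∀ q ∈ slitDomain φ, ∀ z : Fin n → ℝ, z ≠ 0 →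
      0 < z ⬝ᵥ (Matrix.of fun a b => metric (F.loc φ) a b q).mulVec z :=
    fun q hq z hz => F.metric_pos φ hq hz
  intro p hp i α β γ
  have hat : ∀ {g : OscC m → ℝ}, ContDiffOn ℝ ∞ g D → DifferentiableAt ℝ g p := fun hg =>
    (hg.contDiffAt (hDopen.mem_nhds hp)).differentiableAt (by simp)
  refine ricci_identities _ _ (fun a => ?_) (fun i j a b c => hat
      (B.contDiffOn_tangentConn hDopen hW hx hDW hU hF hpos hmaps hmn.le i j a b c))
    (NonlinConn.differentiableAt_delta _
      (fun a b => hat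
        (B.contDiffOn_inducedConn_M1 hDopen hW hx hDW hU hF hpos hmaps hmn.le a b))
      (fun a b => hat
        (B.contDiffOn_inducedConn_M2 hDopen hW hx hDW hU hF hpos hmaps hmn.le a b))) i α β γ
  have hXD : ContDiffOn ℝ ∞ (fun p => Xfield.comp φc p a) D := by
    refine (Xfield.smooth φc a).mono ?_
    rw [hD]
    exact fun q hq => ⟨hq.1, hq.2.2⟩
  exact mod_cast contDiffAt_infty.1 (hXD.contDiffAt (hDopen.mem_nhds hp)) 2
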